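/- **Setting.** Let $D=[0,1]^2$. For $N\in\mathbb N_0$ let $h=1/(N+1)$ and let $V_h\subset H^1_0(D)$ be the conforming P1 finite-element space on the uniform mesh of $(N+1)^2$ congruent squares, each cut into two triangles by its diagonal of direction $(1,1)$, with the nodal basis of hat functions $(\phi_i)$ of the $N^2$ interior nodes. Coefficient vectors in $\mathbb R^{\dim V_h}$ are identified with $N\times N$ arrays, and $\|\mathbf x\|_{H^1(D)}:=\|\sum_i\mathbf x_i\phi_i\|_{H^1(D)}$. For $\boldsymbol\kappa\in\mathbb R^{\dim V_h}$ put $\kappa_h=\sum_i\boldsymbol\kappa_i\phi_i$ and $(A_{\boldsymbol\kappa})_{ij}=\int_D\kappa_h\nabla\phi_j\cdot\nabla\phi_i\,dx$. *Multigrid.* The mesh of $V_h$ arises by $L-1\ge 0$ uniform refinements (each halving the mesh width) from a coarsest mesh with $n_0$ interior nodes per direction, so $1/h=(n_0+1)2^{L-1}$; this gives $V_1\subset\dots\subset V_L=V_h$. Let $P_{\ell-1}$ be the matrix of the embedding $V_{\ell-1}\subset V_\ell$ in the nodal bases. For a damping parameter $\omega>0$, a smoothing step for $A\mathbf u=\mathbf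 f$ is $\mathbf u\mapsto\mathbf u+\omega(\mathbf f-A\mathbf u)$. The V-cycle for $(A,\mathbf f)$ at level $1$ consists of $k_0$ smoothing steps. At level $\ell\ge2$ it performs $k$ smoothing steps, then replaces $\mathbf u$ by $\mathbf u+P_{\ell-1}\mathbf e$, where $\mathbf e$ is the result of one V-cycle at level $\ell-1$ for $(P_{\ell-1}^{T}AP_{\ell-1},\,P_{\ell-1}^{T}(\mathbf f-A\mathbf u))$ started at $\mathbf 0$, and then performs $k$ smoothing steps. $\mathrm{MG}^m_{k_0,k}(\mathbf u_0,\boldsymbol\kappa,\mathbf f)$ denotes the result of $m$ V-cycles at level $L$ for $(A_{\boldsymbol\kappa},\mathbf f)$ started at $\mathbf u_0$. *Networks.* A CNN with activation $\varrho$ maps multi-channel square arrays to such arrays. It is built by composition from zero-padded convolutions, two-strided convolutions (size $2w+1\to w$), two-transpose-strided convolutions (size $w\to 2w+1$), all with biases and square kernels of odd width, from componentwise application of $\varrho$, and from skip connections $x\mapsto[x,f(x)]$ (concatenation of channels, $f$ a CNN preserving the spatial size). Its number of weights $M(\Psi)$ is the number of all kernel entries and biases. A UNet-like network with $0$ down-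 and upsampling stages is a CNN without strided or transpose-strided convolutions; one with $d+1$ stages is such a single-resolution CNN, followed by the skip connection $x\mapsto[x,f(x)]$ around a branch $f$ consisting of a two-strided convolution, a UNet-like network with $d$ stages and a two-transpose-strided convolution, followed by another single-resolution CNN. **Theorem.** There is a constant $C>0$ such that the following holds. Let $\varrho:\mathbb R\to\mathbb R$ be three times continuously differentiable in a neighbourhood of some $x_0\in\mathbb R$ with $\varrho''(x_0)\ne0$. Then for all $n_0\ge0$, $L\ge1$ and $\omega>0$ (with $V_h=V_L$ and $\mathrm{MG}$ as above), all $M,\varepsilon>0$ and all integers $m,k,k_0\ge1$, there is a CNN $\Psi$ with activation $\varrho$, with three input channels and one output channel of size $N\times N$, that is, $\Psi:\mathbb R^{3\times\dim V_h}\to\mathbb R^{\dim V_h}$, which is a composition of $m$ UNet-like networks with $L-1$ down- and upsampling stages each, such that (i) $\|\Psi(\mathbf u_0,\boldsymbol\kappa,\mathbf f)-\mathrm{MG}^m_{k_0,k}(\mathbf u_0,\boldsymbol\kappa,\mathbf f)\|_{H^1(D)}\le\varepsilon$ for all $\mathbf u_0,\boldsymbol\kappa,\mathbf f\in[-M,M]^{\dim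 V_h}$; (ii) $M(\Psi)\le C\left(k_0+k\log\frac1h\right)m$. -/

import Mathlib

open MeasureTheory

noncomputable section

namespace MultigridCNN

/-! ## P1 finite elements on the uniform square mesh of the unit square

The mesh with `N` interior nodes per direction has mesh width `h = 1 / (N + 1)`; each of its
`(N + 1) ^ 2` squares is cut into two triangles by the diagonal of direction `(1, 1)`. -/

/-- The plane with the Euclidean norm. -/
abbrev Plane := EuclideanSpace ℝ (Fin 2)

/-- The closed unit square `D = [0,1]²`. -/
def unitSquare : Set Plane := {p | ∀ i, p i ∈ Set.Icc (0 : ℝ) 1}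

/-- Mesh width of the mesh with `N` interior nodes per direction. -/
def meshWidth (N : ℕ) : ℝ := 1 / ((N : ℝ) + 1)

/-- Indices of the interior nodes, arranged as a two-dimensional array. They index the nodal
basis, so there are `dim V_h = N ^ 2` of them. -/
abbrev Node (N : ℕ) := Fin N × Fin N

/-- Position of an interior node: `((i + 1) h, (j + 1) h)` with `i, j` counted from zero. -/
def nodePos (N : ℕ) (i : Node N) : Plane :=
  !₂[((i.1 : ℝ) + 1) * meshWidth N, ((i.2 : ℝ) + 1) * meshWidth N]

/-- The P1 hat function of an interior node. With `(s, t) = (p - nodePos N i) / h` it is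
`max 0 (1 - max |s| |t| |s - t|)`: it is continuous, affine on every triangle of the mesh, equal
to one at its own node and to zero at all other nodes (those on the boundary included). -/
def hat (N : ℕ) (i : Node N) (p : Plane) : ℝ :=
  let s : ℝ := (p 0 - nodePos N i 0) / meshWidth N
  let t : ℝ := (p 1 - nodePos N i 1) / meshWidth N
  max 0 (1 - max (max |s| |t|) |s - t|)

/-- The finite element function with coefficient vector `x`. -/
def feFun (N : ℕ) (x : Node N → ℝ) (p : Plane) : ℝ := ∑ i, x i * hat N i p

/-- The norm `(∫_D u² + ∫_D |∇u|²)^(1/2)`. It is applied to finite element functions only; these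
are Lipschitz, so that the pointwise gradient, which exists almost everywhere, is the weak one. -/
def normH1 (u : Plane → ℝ) : ℝ :=
  Real.sqrt ((∫ p in unitSquare, u p ^ 2) + ∫ p in unitSquare, ‖gradient u p‖ ^ 2)

/-- The `H¹` norm of a coefficient vector. -/
def coeffNormH1 (N : ℕ) (x : Node N → ℝ) : ℝ := normH1 (feFun N x)

/-- The stiffness matrix `(A_κ)_{ij} = ∫_D κ_h ∇φ_j · ∇φ_i`, where `κ_h ∈ V_h` has the
coefficient vector `κ`. -/
def stiffness (N : ℕ) (κ : Node N → ℝ) : Matrix (Node N) (Node N) ℝ :=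
  fun i j => ∫ p in unitSquare,
    feFun N κ p * inner ℝ (gradient (hat N j) p) (gradient (hat N i) p)

/-- The prolongation matrix: the matrix, in the nodal bases, of the embedding of the space with
mesh width `2h` into the one with mesh width `h`. As the coefficients of a finite element
function are its nodal values, its column of index `I` consists of the values of the coarse hat
function of `I` at the fine nodes. -/
def prolongation (N : ℕ) : Matrix (Node (2 * N + 1)) (Node N) ℝ :=
  fun j I => hat N I (nodePos (2 * N + 1) j)

/-! ## The multigrid V-cycle -/

/-- Interior nodes per direction after `ℓ` uniform refinements of the coarsest mesh, which has
`n₀` of them; thus `1 / h = (n₀ + 1) * 2 ^ ℓ`. -/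
def levelNodes (n₀ : ℕ) : ℕ → ℕ
  | 0 => n₀
  | ℓ + 1 => 2 * levelNodes n₀ ℓ + 1

/-- One damped Richardson step `u ↦ u + ω (f - A u)`. -/
def richardson {ι : Type} [Fintype ι] (ω : ℝ) (A : Matrix ι ι ℝ) (f u : ι → ℝ) : ι → ℝ :=
  u + ω • (f - A.mulVec u)

/-- The V-cycle on the level `ℓ` (the coarsest level being `0`) for `A u = f` with current
iterate `u`: `k₀` Richardson steps on the coarsest level; on the finer levels `k` pre-smoothing
steps, a coarse-grid correction with the restricted residual and the restricted operator
`Pᵀ A P`, and `k` post-smoothing steps. -/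
def vCycle (n₀ : ℕ) (ω : ℝ) (k₀ k : ℕ) : (ℓ : ℕ) →
    Matrix (Node (levelNodes n₀ ℓ)) (Node (levelNodes n₀ ℓ)) ℝ →
    (Node (levelNodes n₀ ℓ) → ℝ) → (Node (levelNodes n₀ ℓ) → ℝ) → Node (levelNodes n₀ ℓ) → ℝ
  | 0, A, f, u => (richardson ω A f)^[k₀] u
  | ℓ + 1, A, f, u =>
    let P : Matrix (Node (levelNodes n₀ (ℓ + 1))) (Node (levelNodes n₀ ℓ)) ℝ :=
      prolongation (levelNodes n₀ ℓ)
    let v := (richardson ω A f)^[k] u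
    let r := P.transpose.mulVec (f - A.mulVec v)
    let e := vCycle n₀ ω k₀ k ℓ (P.transpose * A * P) r 0
    (richardson ω A f)^[k] (v + P.mulVec e)

/-- The result of `m` V-cycles on the level `ℓ` for the operator `A_κ`, started at `u₀`. -/
def multigrid (n₀ : ℕ) (ω : ℝ) (k₀ k m ℓ : ℕ) (u₀ κ f : Node (levelNodes n₀ ℓ) → ℝ) :
    Node (levelNodes n₀ ℓ) → ℝ :=
  (vCycle n₀ ω k₀ k ℓ (stiffness (levelNodes n₀ ℓ) κ) f)^[m] u₀

/-! ## Convolutional neural networks -/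

/-- Tensors with `c` channels and spatial dimensions `w × w`. -/
abbrev Tensor (c w : ℕ) := Fin c → Fin w × Fin w → ℝ

/-- The trainable parameters of a convolution with `c` input channels, `c'` output channels and
kernels of size `(2 r + 1) × (2 r + 1)`: the kernel and one bias for each output channel. -/
structure Kernel (c c' r : ℕ) where
  weight : Fin c → Fin c' → Fin (2 * r + 1) → Fin (2 * r + 1) → ℝ
  bias : Fin c' → ℝ

namespace Kernel

variable {c c' r : ℕ}

/-- The kernel entry at the offset `(d, e)` from the centre; zero outside the kernel window. -/
def tap (K : Kernel c c' r) (a : Fin c) (b : Fin c') (d e : ℤ) : ℝ :=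
  if h : (|d| ≤ (r : ℤ)) ∧ (|e| ≤ (r : ℤ)) then
    K.weight a b
      ⟨(d + r).toNat, by have := abs_le.mp h.1; omega⟩
      ⟨(e + r).toNat, by have := abs_le.mp h.2; omega⟩
  else 0

/-- Vanilla convolution with zero padding: the spatial dimensions are kept. -/
def conv {w : ℕ} (K : Kernel c c' r) (x : Tensor c w) : Tensor c' w := fun b p =>
  K.bias b + ∑ a, ∑ q : Fin w × Fin w,
    K.tap a b ((q.1 : ℤ) - (p.1 : ℤ)) ((q.2 : ℤ) - (p.2 : ℤ)) * x a q

/-- Two-strided convolution with zero padding: the output entry `(i, j)` is centred at the input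
entry `(2 i + 1, 2 j + 1)`, counting from zero. -/
def convStrided {w : ℕ} (K : Kernel c c' r) (x : Tensor c (2 * w + 1)) : Tensor c' w := fun b p =>
  K.bias b + ∑ a, ∑ q : Fin (2 * w + 1) × Fin (2 * w + 1),
    K.tap a b ((q.1 : ℤ) - (2 * (p.1 : ℤ) + 1)) ((q.2 : ℤ) - (2 * (p.2 : ℤ) + 1)) * x a q

/-- Two-transpose-strided convolution: the input entry `(i, j)` is spread by the kernel around
the output entry `(2 i + 1, 2 j + 1)`, counting from zero. -/
def convTransposeStrided {w : ℕ} (K : Kernel c c' r) (x : Tensor c w) : Tensor c' (2 * w + 1) :=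
  fun b p => K.bias b + ∑ a, ∑ q : Fin w × Fin w,
    K.tap a b ((p.1 : ℤ) - (2 * (q.1 : ℤ) + 1)) ((p.2 : ℤ) - (2 * (q.2 : ℤ) + 1)) * x a q

end Kernel

/-- Convolutional networks: `CNN c w c' w'` has inputs with `c` channels of size `w × w` and
outputs with `c'` channels of size `w' × w'`. The building blocks are the three kinds of
convolutions, the componentwise activation, composition, and skip connections, which concatenate
the input of a subnetwork to its output along the channels. -/
inductive CNN : ℕ → ℕ → ℕ → ℕ → Type
  | conv {c c' w r : ℕ} (K : Kernel c c' r) : CNN c w c' w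
  | down {c c' w r : ℕ} (K : Kernel c c' r) : CNN c (2 * w + 1) c' w
  | up {c c' w r : ℕ} (K : Kernel c c' r) : CNN c w c' (2 * w + 1)
  | act {c w : ℕ} : CNN c w c w
  | comp {c w c₁ w₁ c' w' : ℕ} (first : CNN c w c₁ w₁) (second : CNN c₁ w₁ c' w') : CNN c w c' w'
  | skip {c c' w : ℕ} (f : CNN c w c' w) : CNN c w (c + c') w

namespace CNN

/-- The function computed by a network with activation function `ϱ`. -/
def realize (ϱ : ℝ → ℝ) : {c w c' w' : ℕ} → CNN c w c' w' → Tensor c w → Tensor c' w'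
  | _, _, _, _, conv K => fun x => K.conv x
  | _, _, _, _, down K => fun x => K.convStrided x
  | _, _, _, _, up K => fun x => K.convTransposeStrided x
  | _, _, _, _, act => fun x a p => ϱ (x a p)
  | _, _, _, _, comp f g => fun x => realize ϱ g (realize ϱ f x)
  | _, _, _, _, skip f => fun x => Fin.append x (realize ϱ f x)

/-- The number of weights: all kernel entries and biases (zero or not) of all convolutions. -/
def numWeights : {c w c' w' : ℕ} → CNN c w c' w' → ℕ
  | _, _, _, _, @conv c c' _ r _ => c * c' * (2 * r + 1) ^ 2 + c'
  | _, _, _, _, @down c c' _ r _ => c * c' * (2 * r + 1) ^ 2 + c'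
  | _, _, _, _, @up c c' _ r _ => c * c' * (2 * r + 1) ^ 2 + c'
  | _, _, _, _, act => 0
  | _, _, _, _, comp f g => numWeights f + numWeights g
  | _, _, _, _, skip f => numWeights f

/-- Networks that stay on one resolution: no strided and no transpose-strided convolutions. -/
inductive IsSingleScale : {c w c' w' : ℕ} → CNN c w c' w' → Prop
  | conv {c c' w r : ℕ} (K : Kernel c c' r) : IsSingleScale (CNN.conv (w := w) K)
  | act {c w : ℕ} : IsSingleScale (CNN.act (c := c) (w := w))
  | comp {c c₁ c' w : ℕ} {f : CNN c w c₁ w} {g : CNN c₁ w c' w} :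
      IsSingleScale f → IsSingleScale g → IsSingleScale (CNN.comp f g)
  | skip {c c' w : ℕ} {f : CNN c w c' w} : IsSingleScale f → IsSingleScale (CNN.skip f)

/-- UNet-like networks with `d` down- and upsampling stages. For `d = 0` this is a single-scale
network. With one more stage: a single-scale network on the fine resolution, then a branch which
downsamples by a strided convolution, applies a UNet-like network on the coarse resolution and
upsamples by a transpose-strided convolution, with a skip connection across this branch, and
finally a single-scale network on the fine resolution. -/
inductive IsUNet : {c w c' w' : ℕ} → ℕ → CNN c w c' w' → Prop
  | coarsest {c c' w : ℕ} {f : CNN c w c' w} : IsSingleScale f → IsUNet 0 f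
  | stage {d c c₁ c₂ c₃ c₄ c' w r r' : ℕ}
      {pre : CNN c (2 * w + 1) c₁ (2 * w + 1)} (Kdown : Kernel c₁ c₂ r)
      {inner : CNN c₂ w c₃ w} (Kup : Kernel c₃ c₄ r')
      {post : CNN (c₁ + c₄) (2 * w + 1) c' (2 * w + 1)} :
      IsSingleScale pre → IsUNet d inner → IsSingleScale post →
      IsUNet (d + 1)
        (CNN.comp pre
          (CNN.comp (CNN.skip (CNN.comp (CNN.down Kdown) (CNN.comp inner (CNN.up Kup)))) post))

/-- Compositions of `m` UNet-like networks with `d` down- and upsampling stages each. -/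
inductive IsUNetSequence (d : ℕ) : {c w c' w' : ℕ} → ℕ → CNN c w c' w' → Prop
  | single {c c' w : ℕ} {f : CNN c w c' w} : IsUNet d f → IsUNetSequence d 1 f
  | cons {m c c₁ c' w : ℕ} {f : CNN c w c₁ w} {g : CNN c₁ w c' w} :
      IsUNet d f → IsUNetSequence d m g → IsUNetSequence d (m + 1) (CNN.comp f g)

end CNN

end MultigridCNN

end

/-!
A V-cycle consists of affine maps with `3 × 3` stencils, which are convolutions, and of one
nonlinear operation: the multiplication of the entries of the system matrix, which depend on the input `κ`,
by shifted copies of the iterate. A mixed second difference of `ϱ` at `x₀` approximates a product on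
bounded sets to any accuracy with a fixed number of weights (`exists_mul_approx`), because
`ϱ''(x₀) ≠ 0`; all arguments of `ϱ` stay close to `x₀`, where alone it is known to be regular. Skip
connections carry the remaining data along exactly.

Errors need not be tracked. The notion `Approximable` asks for a continuous map to be approximated
uniformly on every bounded set by networks whose size depends neither on the set nor on the
accuracy, and it is stable under composition and skip connections (`Approximable.comp`,
`Approximable.skip`). Thus only exact identities between maps and a count of weights are left.

The networks carry a `State`: iterate, residual, right-hand side, coefficient, and the matrix of
the current level as nine arrays, one for each offset in the window. On the finest level these
arrays are a convolution of `κ`, since the hat functions are translates of one profile and the integrals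
over the plane are translation invariant (`stiffness_eq`); no integral has to be computed. On the
coarser levels the Galerkin product `Pᵀ A P` of a nine-point stencil is again a nine-point stencil,
and it arises from the fine one by a strided convolution (`galerkin_stencilMatrix`). Restriction and
prolongation are strided and transpose-strided convolutions because the values of a coarse hat
function at fine nodes depend only on the offset (`prolongation_eq`). So each V-cycle is a UNet-like
map with a bounded number of weights per smoothing step and per level
(`State.approximable_vCycleMap`), and `log (1 / h)` is at least a multiple of the number of levels.
On a fixed mesh the `H¹` norm is bounded by the maximum norm (`exists_coeffNormH1_le`).
-/

namespace MultigridCNN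

/-! ### Affine maps given by convolutions -/

/-- The `3 × 3` window of offsets seen by a kernel with `r = 1`. -/
def InWindow (d : ℤ × ℤ) : Prop := |d.1| ≤ 1 ∧ |d.2| ≤ 1

/-- A map from tensors to arrays which is affine and in which the influence of the input entry `q`
on the output entry `p` depends only on the offset `o q p`, and vanishes unless this offset lies in
the `3 × 3` window. The choice of `o` distinguishes the three kinds of convolutions. -/
def IsLocal {c w w' : ℕ} (o : Node w → Node w' → ℤ × ℤ) (g : Tensor c w → Node w' → ℝ) : Prop :=
  ∃ (k : Fin c → ℤ × ℤ → ℝ) (β : ℝ), (∀ a d, ¬ InWindow d → k a d = 0) ∧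
    ∀ x p, g x p = β + ∑ a, ∑ q, k a (o q p) * x a q

/-- Offsets of a vanilla convolution. -/
def plainOffset {w : ℕ} (q p : Node w) : ℤ × ℤ := ((q.1 : ℤ) - p.1, (q.2 : ℤ) - p.2)

/-- Offsets of a two-strided convolution. -/
def downOffset {w : ℕ} (q : Node (2 * w + 1)) (p : Node w) : ℤ × ℤ :=
  ((q.1 : ℤ) - (2 * (p.1 : ℤ) + 1), (q.2 : ℤ) - (2 * (p.2 : ℤ) + 1))

/-- Offsets of a two-transpose-strided convolution. -/
def upOffset {w : ℕ} (q : Node w) (p : Node (2 * w + 1)) : ℤ × ℤ := downOffset p q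

namespace IsLocal

variable {c w w' : ℕ} {o : Node w → Node w' → ℤ × ℤ}

lemma const (β : ℝ) : IsLocal o (fun (_ : Tensor c w) _ => β) :=
  ⟨0, β, by simp, by simp⟩

/-- The elementary local map: a tap function with support in the window applied to one channel. -/
lemma atom (k : ℤ × ℤ → ℝ) (hk : ∀ d, ¬ InWindow d → k d = 0) (a : Fin c) :
    IsLocal o (fun (x : Tensor c w) p => ∑ q, k (o q p) * x a q) := by
  refine ⟨fun b d => if b = a then k d else 0, 0, ?_, ?_⟩
  · intro b d hd
    simp [hk d hd]
  · intro x p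
    rw [zero_add, Finset.sum_eq_single a]
    · simp
    · intro b _ hb
      simp [hb]
    · simp

lemma add {g h : Tensor c w → Node w' → ℝ} (hg : IsLocal o g) (hh : IsLocal o h) :
    IsLocal o (fun x p => g x p + h x p) := by
  obtain ⟨k, β, hk, hg⟩ := hg
  obtain ⟨l, γ, hl, hh⟩ := hh
  refine ⟨k + l, β + γ, ?_, ?_⟩
  · intro a d hd
    simp [hk a d hd, hl a d hd]
  · intro x p
    simp only [hg, hh, Pi.add_apply, add_mul, Finset.sum_add_distrib]
    ring

lemma const_mul (t : ℝ) {g : Tensor c w → Node w' → ℝ} (hg : IsLocal o g) :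
    IsLocal o (fun x p => t * g x p) := by
  obtain ⟨k, β, hk, hg⟩ := hg
  refine ⟨t • k, t * β, ?_, ?_⟩
  · intro a d hd
    simp [hk a d hd]
  · intro x p
    simp only [hg, Pi.smul_apply, smul_eq_mul, mul_add, Finset.mul_sum, mul_assoc]

lemma sub {g h : Tensor c w → Node w' → ℝ} (hg : IsLocal o g) (hh : IsLocal o h) :
    IsLocal o (fun x p => g x p - h x p) := by
  simpa [sub_eq_add_neg] using hg.add (hh.const_mul (-1))

lemma sum {n : ℕ} {g : Fin n → Tensor c w → Node w' → ℝ} (hg : ∀ s, IsLocal o (g s)) :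
    IsLocal o (fun x p => ∑ s, g s x p) := by
  choose k β hk hg using hg
  refine ⟨∑ s, k s, ∑ s, β s, ?_, ?_⟩
  · intro a d hd
    simp [hk _ a d hd]
  · intro x p
    simp only [hg, Finset.sum_apply, Finset.sum_mul, Finset.sum_add_distrib]
    congr 1
    rw [Finset.sum_comm]
    refine Finset.sum_congr rfl fun a _ => ?_
    rw [Finset.sum_comm]

lemma proj (a : Fin c) : IsLocal plainOffset (fun (x : Tensor c w) => x a) := by
  have h := atom (c := c) (o := plainOffset (w := w)) (fun d => if d = 0 then 1 else 0)
    (by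
      intro d hd
      rw [if_neg]
      rintro rfl
      exact hd (by simp [InWindow])) a
  convert h using 3 with x p
  rw [Finset.sum_eq_single p]
  · simp [plainOffset]
  · intro q _ hq
    have : plainOffset q p ≠ 0 := by
      intro h0
      apply hq
      simp only [plainOffset, Prod.mk_eq_zero] at h0
      ext <;> omega
    simp [this]
  · simp

end IsLocal

/-- The kernel of width three with prescribed entries. -/
noncomputable def Kernel.ofTaps {c c' : ℕ} (k : Fin c → Fin c' → ℤ × ℤ → ℝ) (β : Fin c' → ℝ) :
    Kernel c c' 1 :=
  ⟨fun a b i j => k a b ((i : ℤ) - 1, (j : ℤ) - 1), β⟩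

lemma Kernel.tap_ofTaps {c c' : ℕ} (k : Fin c → Fin c' → ℤ × ℤ → ℝ) (β : Fin c' → ℝ)
    (hk : ∀ a b d, ¬ InWindow d → k a b d = 0) (a : Fin c) (b : Fin c') (d e : ℤ) :
    (Kernel.ofTaps k β).tap a b d e = k a b (d, e) := by
  unfold Kernel.tap
  split_ifs with h
  · have h1 := abs_le.mp h.1
    have h2 := abs_le.mp h.2
    simp only [Nat.cast_one] at h1 h2
    simp only [Kernel.ofTaps]
    congr 2 <;> · simp; omega
  · exact (hk a b _ (by simpa [InWindow] using h)).symm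

/-- A map all of whose output channels are local is given by one kernel, read off at the offsets. -/
lemma exists_taps {c c' w w' : ℕ} {o : Node w → Node w' → ℤ × ℤ}
    {F : Tensor c w → Tensor c' w'} (hF : ∀ b, IsLocal o (fun x => F x b)) :
    ∃ K : Kernel c c' 1, ∀ x b p,
      F x b p = K.bias b + ∑ a, ∑ q, K.tap a b (o q p).1 (o q p).2 * x a q := by
  choose k β hk hF using hF
  refine ⟨Kernel.ofTaps (fun a b => k b a) β, fun x b p => ?_⟩
  simp only [Kernel.tap_ofTaps (fun a b => k b a) β (fun a b => hk b a), hF]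
  rfl

/-! ### Approximability by networks of bounded size -/

/-- The map `F` is continuous and, on every bounded set and to any accuracy, approximated by
networks of the class `S` with at most `W` weights. Uniformity of the size in the bounded set and
in the accuracy is what makes this notion stable under composition. -/
def Approximable (ϱ : ℝ → ℝ) {c w c' w' : ℕ} (S : CNN c w c' w' → Prop) (W : ℕ)
    (F : Tensor c w → Tensor c' w') : Prop :=
  Continuous F ∧ ∀ R ε : ℝ, 0 < ε → ∃ Ψ : CNN c w c' w', S Ψ ∧ Ψ.numWeights ≤ W ∧
    ∀ x, ‖x‖ ≤ R → ‖Ψ.realize ϱ x - F x‖ ≤ ε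

namespace Approximable

variable {ϱ : ℝ → ℝ} {c w c' w' c'' w'' : ℕ}

lemma mono {S S' : CNN c w c' w' → Prop} {W W' : ℕ} {F : Tensor c w → Tensor c' w'}
    (h : Approximable ϱ S W F) (hS : ∀ Ψ, S Ψ → S' Ψ) (hW : W ≤ W') : Approximable ϱ S' W' F := by
  refine ⟨h.1, fun R ε hε => ?_⟩
  obtain ⟨Ψ, h1, h2, h3⟩ := h.2 R ε hε
  exact ⟨Ψ, hS _ h1, h2.trans hW, h3⟩

/-- Composition: on a bounded set the inner approximations stay in a bounded set, on which the
outer map is uniformly continuous. -/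
lemma comp {S : CNN c w c' w' → Prop} {S' : CNN c' w' c'' w'' → Prop}
    {T : CNN c w c'' w'' → Prop} {W W' : ℕ}
    {F : Tensor c w → Tensor c' w'} {G : Tensor c' w' → Tensor c'' w''}
    (hG : Approximable ϱ S' W' G) (hF : Approximable ϱ S W F)
    (hT : ∀ Φ Ψ, S Φ → S' Ψ → T (Φ.comp Ψ)) :
    Approximable ϱ T (W + W') (fun x => G (F x)) := by
  refine ⟨hG.1.comp hF.1, fun R ε hε => ?_⟩
  obtain ⟨R', hR'⟩ : ∃ R', ∀ x, ‖x‖ ≤ R → ‖F x‖ ≤ R' := by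
    obtain ⟨R', h⟩ := (isCompact_closedBall (0 : Tensor c w) R).exists_bound_of_continuousOn
      hF.1.continuousOn
    exact ⟨R', fun x hx => h x (by simpa using hx)⟩
  have hunif : UniformContinuousOn G (Metric.closedBall 0 (R' + 1)) :=
    (isCompact_closedBall _ _).uniformContinuousOn_of_continuous hG.1.continuousOn
  obtain ⟨δ, hδ, hGδ⟩ := Metric.uniformContinuousOn_iff.1 hunif (ε / 2) (half_pos hε)
  obtain ⟨Φ, hΦS, hΦW, hΦ⟩ := hF.2 R (min 1 (δ / 2)) (by positivity)
  obtain ⟨Ψ, hΨS, hΨW, hΨ⟩ := hG.2 (R' + 1) (ε / 2) (half_pos hε)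
  refine ⟨Φ.comp Ψ, hT _ _ hΦS hΨS, by simp only [CNN.numWeights]; omega, fun x hx => ?_⟩
  have h1 := hΦ x hx
  have h2 := hR' x hx
  have h3 : ‖Φ.realize ϱ x‖ ≤ R' + 1 := by
    calc ‖Φ.realize ϱ x‖ = ‖F x + (Φ.realize ϱ x - F x)‖ := by congr 1; abel
      _ ≤ ‖F x‖ + ‖Φ.realize ϱ x - F x‖ := norm_add_le _ _
      _ ≤ R' + 1 := add_le_add h2 (h1.trans (min_le_left _ _))
  have h4 := hΨ _ h3
  have h5 : ‖G (Φ.realize ϱ x) - G (F x)‖ < ε / 2 := by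
    rw [← dist_eq_norm]
    refine hGδ _ (by simpa using h3) _ (by simpa using h2.trans (by linarith)) ?_
    rw [dist_eq_norm]
    exact (h1.trans (min_le_right _ _)).trans_lt (by linarith)
  calc ‖(Φ.comp Ψ).realize ϱ x - G (F x)‖
      = ‖(Ψ.realize ϱ (Φ.realize ϱ x) - G (Φ.realize ϱ x)) + (G (Φ.realize ϱ x) - G (F x))‖ := by
        simp only [CNN.realize]; congr 1; abel
    _ ≤ ε / 2 + ε / 2 := (norm_add_le _ _).trans (add_le_add h4 h5.le)
    _ = ε := by ring

lemma skip {S : CNN c w c' w → Prop} {T : CNN c w (c + c') w → Prop} {W : ℕ}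
    {F : Tensor c w → Tensor c' w} (hF : Approximable ϱ S W F) (hT : ∀ Φ, S Φ → T Φ.skip) :
    Approximable ϱ T W (fun x => Fin.append x (F x)) := by
  refine ⟨?_, fun R ε hε => ?_⟩
  · refine continuous_pi fun a => ?_
    induction a using Fin.addCases with
    | left a => simpa using continuous_apply a
    | right a => simpa [Function.comp_def] using (continuous_apply a).comp hF.1
  · obtain ⟨Φ, hS, hW, hΦ⟩ := hF.2 R ε hε
    refine ⟨Φ.skip, hT _ hS, by simpa only [CNN.numWeights] using hW, fun x hx => ?_⟩
    have h := hΦ x hx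
    rw [pi_norm_le_iff_of_nonneg hε.le] at h ⊢
    intro a
    induction a using Fin.addCases with
    | left a => simp [CNN.realize, hε.le]
    | right a => simpa [CNN.realize] using h a

lemma of_conv {F : Tensor c w → Tensor c' w} (hF : ∀ b, IsLocal plainOffset (fun x => F x b)) :
    Approximable ϱ CNN.IsSingleScale (c * c' * 9 + c') F := by
  obtain ⟨K, hK⟩ := exists_taps hF
  have : F = K.conv := by
    funext x b p
    exact hK x b p
  subst this
  refine ⟨by unfold Kernel.conv; fun_prop, fun R ε hε => ⟨.conv K, .conv K, le_rfl, fun x _ => ?_⟩⟩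
  simp [CNN.realize, hε.le]

lemma of_down {F : Tensor c (2 * w + 1) → Tensor c' w}
    (hF : ∀ b, IsLocal downOffset (fun x => F x b)) :
    Approximable ϱ (fun Φ => ∃ K : Kernel c c' 1, Φ = .down K) (c * c' * 9 + c') F := by
  obtain ⟨K, hK⟩ := exists_taps hF
  have : F = K.convStrided := by
    funext x b p
    exact hK x b p
  subst this
  refine ⟨by unfold Kernel.convStrided; fun_prop,
    fun R ε hε => ⟨.down K, ⟨K, rfl⟩, le_rfl, fun x _ => ?_⟩⟩
  simp [CNN.realize, hε.le]

lemma of_up {F : Tensor c w → Tensor c' (2 * w + 1)}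
    (hF : ∀ b, IsLocal upOffset (fun x => F x b)) :
    Approximable ϱ (fun Φ => ∃ K : Kernel c c' 1, Φ = .up K) (c * c' * 9 + c') F := by
  obtain ⟨K, hK⟩ := exists_taps hF
  have : F = K.convTransposeStrided := by
    funext x b p
    exact hK x b p
  subst this
  refine ⟨by unfold Kernel.convTransposeStrided; fun_prop,
    fun R ε hε => ⟨.up K, ⟨K, rfl⟩, le_rfl, fun x _ => ?_⟩⟩
  simp [CNN.realize, hε.le]

lemma comp_single {W W' : ℕ} {F : Tensor c w → Tensor c' w} {G : Tensor c' w → Tensor c'' w}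
    (hG : Approximable ϱ CNN.IsSingleScale W' G) (hF : Approximable ϱ CNN.IsSingleScale W F) :
    Approximable ϱ CNN.IsSingleScale (W + W') (fun x => G (F x)) :=
  hG.comp hF fun _ _ => .comp

/-- The identity costs one convolution, hence the first summand. -/
lemma iterate {W : ℕ} {F : Tensor c w → Tensor c w}
    (hF : Approximable ϱ CNN.IsSingleScale W F) (k : ℕ) :
    Approximable ϱ CNN.IsSingleScale (c * c * 9 + c + k * W) F^[k] := by
  induction k with
  | zero => exact (of_conv fun b => IsLocal.proj b).mono (fun _ => id) (by omega)
  | succ k ih =>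
    rw [Function.iterate_succ']
    exact (hF.comp_single ih).mono (fun _ => id) (by rw [Nat.succ_mul]; omega)

end Approximable

/-! ### Multiplication -/

open Filter Topology in
/-- Second order Taylor expansion with the Peano remainder. -/
lemma taylor_two {ϱ : ℝ → ℝ} {x₀ : ℝ} (h : ContDiffAt ℝ 3 ϱ x₀) {η : ℝ} (hη : 0 < η) :
    ∃ δ > 0, ∀ s, |s| ≤ δ →
      |ϱ (x₀ + s) - (ϱ x₀ + deriv ϱ x₀ * s + iteratedDeriv 2 ϱ x₀ / 2 * s ^ 2)| ≤ η * s ^ 2 := by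
  obtain ⟨u, hu, hϱ⟩ := (h.of_le (m := 2) (by norm_num)).contDiffOn le_rfl (by simp)
  obtain ⟨r, hr, hru⟩ := Metric.mem_nhds_iff.1 hu
  have ho : IsOpen (Metric.ball x₀ r) := Metric.isOpen_ball
  have hx : x₀ ∈ Metric.ball x₀ r := Metric.mem_ball_self hr
  have ht := taylor_isLittleO (convex_ball x₀ r) hx (n := 2) (by exact_mod_cast hϱ.mono hru)
  rw [ho.nhdsWithin_eq hx, Asymptotics.isLittleO_iff] at ht
  obtain ⟨δ, hδ, hb⟩ := Metric.eventually_nhds_iff.1 (ht hη)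
  refine ⟨δ / 2, half_pos hδ, fun s hs => ?_⟩
  have key := hb (y := x₀ + s) (by simpa using hs.trans_lt (half_lt_self hδ))
  simp only [taylor_within_apply, Finset.sum_range_succ, Finset.sum_range_zero,
    iteratedDerivWithin_of_isOpen ho hx, iteratedDeriv_zero, iteratedDeriv_one] at key
  simpa [Nat.factorial, div_mul_eq_mul_div, mul_comm, div_eq_mul_inv, mul_assoc, mul_left_comm]
    using key

/-- The mixed second difference of `ϱ` at `x₀`, suitably scaled, approximates the product. -/
lemma exists_mul_approx {ϱ : ℝ → ℝ} {x₀ : ℝ} (h : ContDiffAt ℝ 3 ϱ x₀)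
    (h2 : iteratedDeriv 2 ϱ x₀ ≠ 0) (R ε : ℝ) (hε : 0 < ε) :
    ∃ t γ : ℝ, ∀ x y : ℝ, |x| ≤ R → |y| ≤ R →
      |γ * (ϱ (x₀ + t * (x + y)) - ϱ (x₀ + t * x) - ϱ (x₀ + t * y) + ϱ x₀) - x * y| ≤ ε := by
  set D := iteratedDeriv 2 ϱ x₀ with hD
  set B := |R| + 1 with hB
  have hB0 : 0 < B := by positivity
  -- The three remainders add up to at most `6 η (t B)²`, and `6 η B² = ε |D|`.
  obtain ⟨δ, hδ, hT⟩ := taylor_two h (η := ε * |D| / (6 * B ^ 2)) (by positivity)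
  set t := δ / (2 * B) with ht
  have ht0 : 0 < t := by positivity
  have htB : t * B = δ / 2 := by rw [ht]; field_simp
  refine ⟨t, (t ^ 2 * D)⁻¹, fun x y hx hy => ?_⟩
  have hx' : |x| ≤ B := hx.trans ((le_abs_self R).trans (by linarith))
  have hy' : |y| ≤ B := hy.trans ((le_abs_self R).trans (by linarith))
  have hb : ∀ z b, |z| ≤ b * B → b ≤ 2 → |t * z| ≤ δ := fun z b hz hb2 => by
    rw [abs_mul, abs_of_pos ht0]
    calc t * |z| ≤ t * (2 * B) := by gcongr; exact hz.trans (by gcongr)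
      _ = δ := by rw [ht]; field_simp
  have h1 := hT _ (hb (x + y) 2 ((abs_add_le x y).trans (by linarith)) le_rfl)
  have h2' := hT _ (hb x 1 (by simpa using hx') (by norm_num))
  have h3 := hT _ (hb y 1 (by simpa using hy') (by norm_num))
  rw [← hD] at h1 h2' h3
  set e1 := ϱ (x₀ + t * (x + y)) -
    (ϱ x₀ + deriv ϱ x₀ * (t * (x + y)) + D / 2 * (t * (x + y)) ^ 2) with he1
  set e2 := ϱ (x₀ + t * x) - (ϱ x₀ + deriv ϱ x₀ * (t * x) + D / 2 * (t * x) ^ 2) with he2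
  set e3 := ϱ (x₀ + t * y) - (ϱ x₀ + deriv ϱ x₀ * (t * y) + D / 2 * (t * y) ^ 2) with he3
  have hid : (t ^ 2 * D)⁻¹ * (ϱ (x₀ + t * (x + y)) - ϱ (x₀ + t * x) - ϱ (x₀ + t * y) + ϱ x₀)
      - x * y = (t ^ 2 * D)⁻¹ * (e1 - e2 - e3) := by
    rw [he1, he2, he3]
    field_simp
    ring
  have hxx : x ^ 2 ≤ B ^ 2 := sq_le_sq' (abs_le.1 hx').1 (abs_le.1 hx').2
  have hyy : y ^ 2 ≤ B ^ 2 := sq_le_sq' (abs_le.1 hy').1 (abs_le.1 hy').2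
  have hxy : (x + y) ^ 2 ≤ 4 * B ^ 2 := by nlinarith [sq_nonneg (x - y)]
  rw [hid, abs_mul, abs_inv, abs_mul, abs_of_pos (pow_pos ht0 2)]
  have hsum : |e1 - e2 - e3| ≤ t ^ 2 * |D| * ε := by
    calc |e1 - e2 - e3| ≤ |e1| + |e2| + |e3| := by
          have := abs_sub (e1 - e2) e3
          have := abs_sub e1 e2
          linarith
      _ ≤ ε * |D| / (6 * B ^ 2) * (t * (x + y)) ^ 2 + ε * |D| / (6 * B ^ 2) * (t * x) ^ 2
          + ε * |D| / (6 * B ^ 2) * (t * y) ^ 2 := by gcongr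
      _ = ε * |D| / (6 * B ^ 2) * t ^ 2 * ((x + y) ^ 2 + x ^ 2 + y ^ 2) := by ring
      _ ≤ ε * |D| / (6 * B ^ 2) * t ^ 2 * (6 * B ^ 2) := by gcongr; linarith
      _ = t ^ 2 * |D| * ε := by field_simp
  rw [inv_mul_le_iff₀ (by positivity)]
  exact hsum

/-- The pointwise product of two channels. -/
def mulChannels {w : ℕ} (x : Tensor 2 w) : Tensor 1 w := fun _ p => x 0 p * x 1 p

lemma approximable_mulChannels {ϱ : ℝ → ℝ} {x₀ : ℝ} (h : ContDiffAt ℝ 3 ϱ x₀)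
    (h2 : iteratedDeriv 2 ϱ x₀ ≠ 0) (w : ℕ) :
    Approximable ϱ CNN.IsSingleScale 85 (mulChannels (w := w)) := by
  refine ⟨by unfold mulChannels; fun_prop, fun R ε hε => ?_⟩
  obtain ⟨t, γ, ht⟩ := exists_mul_approx h h2 R ε hε
  obtain ⟨K, hK⟩ := exists_taps (o := plainOffset (w := w))
    (F := fun (x : Tensor 2 w) => (![fun p => x₀ + t * (x 0 p + x 1 p),
      fun p => x₀ + t * x 0 p, fun p => x₀ + t * x 1 p] : Tensor 3 w)) (by
    intro b
    fin_cases b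
    · exact (IsLocal.const x₀).add (((IsLocal.proj 0).add (IsLocal.proj 1)).const_mul t)
    · exact (IsLocal.const x₀).add ((IsLocal.proj 0).const_mul t)
    · exact (IsLocal.const x₀).add ((IsLocal.proj 1).const_mul t))
  obtain ⟨K', hK'⟩ := exists_taps (o := plainOffset (w := w))
    (F := fun (x : Tensor 3 w) =>
      ((fun _ p => γ * (x 0 p - x 1 p - x 2 p + ϱ x₀)) : Tensor 1 w)) (by
    intro b
    exact ((((IsLocal.proj 0).sub (IsLocal.proj 1)).sub (IsLocal.proj 2)).add
      (IsLocal.const _)).const_mul γ)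
  refine ⟨.comp (.conv K) (.comp .act (.conv K')), .comp (.conv K) (.comp .act (.conv K')),
    le_rfl, fun x hx => ?_⟩
  rw [pi_norm_le_iff_of_nonneg hε.le]
  intro b
  rw [pi_norm_le_iff_of_nonneg hε.le]
  intro p
  have hx' : ∀ a, |x a p| ≤ R := fun a =>
    ((norm_le_pi_norm (x a) p).trans (norm_le_pi_norm x a)).trans hx
  have e1 : K.conv x = ![fun p => x₀ + t * (x 0 p + x 1 p),
      fun p => x₀ + t * x 0 p, fun p => x₀ + t * x 1 p] := by
    funext b p
    exact (hK x b p).symm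
  have e2 : ∀ y : Tensor 3 w, K'.conv y b p = γ * (y 0 p - y 1 p - y 2 p + ϱ x₀) := fun y =>
    (hK' y b p).symm
  simp only [CNN.realize, Pi.sub_apply, e1, e2, mulChannels]
  exact ht _ _ (hx' 0) (hx' 1)

/-! ### Hat functions as translates of one profile -/

/-- The hat function of the node at the origin on the mesh of width `h`. -/
noncomputable def hatProfile (h : ℝ) (p : Plane) : ℝ :=
  max 0 (1 - max (max |p 0 / h| |p 1 / h|) |p 0 / h - p 1 / h|)

/-- The points of the lattice `h ℤ²`. -/
noncomputable def latticePt (h : ℝ) (d : ℤ × ℤ) : Plane := !₂[(d.1 : ℝ) * h, (d.2 : ℝ) * h]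

lemma latticePt_add (h : ℝ) (d e : ℤ × ℤ) :
    latticePt h (d + e) = latticePt h d + latticePt h e := by
  ext i
  fin_cases i <;> simp [latticePt, add_mul]

/-- Integer coordinates of a node, counted from the boundary of the square. -/
def nodeIdx {N : ℕ} (i : Node N) : ℤ × ℤ := ((i.1 : ℤ) + 1, (i.2 : ℤ) + 1)

lemma meshWidth_pos (N : ℕ) : 0 < meshWidth N := by unfold meshWidth; positivity

lemma nodePos_eq (N : ℕ) (i : Node N) : nodePos N i = latticePt (meshWidth N) (nodeIdx i) := by
  ext k
  fin_cases k <;> simp [nodePos, latticePt, nodeIdx]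

lemma hat_eq (N : ℕ) (i : Node N) (p : Plane) :
    hat N i p = hatProfile (meshWidth N) (p - latticePt (meshWidth N) (nodeIdx i)) := by
  rw [← nodePos_eq]
  simp [hat, hatProfile]

lemma gradient_hat (N : ℕ) (i : Node N) (p : Plane) :
    gradient (hat N i) p =
      gradient (hatProfile (meshWidth N)) (p - latticePt (meshWidth N) (nodeIdx i)) := by
  have : hat N i = fun p => hatProfile (meshWidth N) (p - latticePt (meshWidth N) (nodeIdx i)) :=
    funext (hat_eq N i)
  rw [this, gradient, gradient, fderiv_comp_sub]

lemma hatProfile_nonneg (h : ℝ) (p : Plane) : 0 ≤ hatProfile h p := le_max_left _ _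

lemma hatProfile_le_one (h : ℝ) (p : Plane) : hatProfile h p ≤ 1 :=
  max_le zero_le_one (sub_le_self _ ((abs_nonneg _).trans (le_max_right _ _)))

lemma abs_lt_of_hatProfile_ne_zero {h : ℝ} (hh : 0 < h) {p : Plane} (hp : hatProfile h p ≠ 0) :
    |p 0| < h ∧ |p 1| < h := by
  have h1 : 0 < 1 - max (max |p 0 / h| |p 1 / h|) |p 0 / h - p 1 / h| := by
    by_contra hc
    exact hp (max_eq_left (not_lt.1 hc))
  have h2 : max (max |p 0 / h| |p 1 / h|) |p 0 / h - p 1 / h| < 1 := by linarith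
  obtain ⟨⟨h3, h4⟩, -⟩ := by simpa only [max_lt_iff] using h2
  rw [abs_div, abs_of_pos hh, div_lt_one hh] at h3 h4
  exact ⟨h3, h4⟩

/-- Where the profile vanishes it is minimal, so that its gradient vanishes there as well, even on
the boundary of the support. -/
lemma hatProfile_ne_zero_of_gradient {h : ℝ} {p : Plane}
    (hp : gradient (hatProfile h) p ≠ 0) : hatProfile h p ≠ 0 := by
  intro h0
  apply hp
  have : IsLocalMin (hatProfile h) p :=
    Filter.Eventually.of_forall fun q => h0 ▸ hatProfile_nonneg h q
  rw [gradient, this.fderiv_eq_zero, map_zero]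

lemma exists_lipschitzWith_hatProfile (h : ℝ) : ∃ K, LipschitzWith K (hatProfile h) := by
  have hc : ∀ i : Fin 2, ∃ K, LipschitzWith K fun p : Plane => p i / h := fun i =>
    ⟨‖h⁻¹ • (EuclideanSpace.proj i : Plane →L[ℝ] ℝ)‖₊, by
      have hl : (fun p : Plane => p i / h) = ⇑(h⁻¹ • (EuclideanSpace.proj i : Plane →L[ℝ] ℝ)) := by
        ext p
        simp [div_eq_inv_mul]
      rw [hl]
      exact ContinuousLinearMap.lipschitz _⟩
  have habs : LipschitzWith 1 fun x : ℝ => |x| := lipschitzWith_one_norm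
  obtain ⟨K₀, h₀⟩ := hc 0
  obtain ⟨K₁, h₁⟩ := hc 1
  exact ⟨_, (((LipschitzWith.const (1 : ℝ)).sub
    (((habs.comp h₀).max (habs.comp h₁)).max (habs.comp (h₀.sub h₁))))).const_max 0⟩

lemma exists_norm_gradient_le (h : ℝ) : ∃ K : ℝ, ∀ p, ‖gradient (hatProfile h) p‖ ≤ K := by
  obtain ⟨K, hK⟩ := exists_lipschitzWith_hatProfile h
  exact ⟨K, fun p => by
    rw [gradient, LinearIsometryEquiv.norm_map]
    exact norm_fderiv_le_of_lipschitz ℝ hK⟩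

lemma continuous_hatProfile (h : ℝ) : Continuous (hatProfile h) :=
  (exists_lipschitzWith_hatProfile h).choose_spec.continuous

lemma measurable_gradient (f : Plane → ℝ) : Measurable (gradient f) := by
  unfold gradient
  exact (InnerProductSpace.toDual ℝ Plane).symm.continuous.measurable.comp (measurable_fderiv ℝ f)

lemma volume_unitSquare_lt_top : volume unitSquare < ⊤ := by
  refine Bornology.IsBounded.measure_lt_top (Metric.isBounded_iff_subset_closedBall 0 |>.2 ⟨2, ?_⟩)
  intro p hp
  rw [mem_closedBall_zero_iff, EuclideanSpace.norm_eq, Real.sqrt_le_iff]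
  refine ⟨by norm_num, ?_⟩
  have h0 := hp 0
  have h1 := hp 1
  simp only [Fin.sum_univ_two, Real.norm_eq_abs, sq_abs]
  nlinarith [h0.1, h0.2, h1.1, h1.2]

/-! ### The stiffness matrix is a translation invariant stencil -/

/-- The integral over the plane of the hat function at the offset `d` against the product of
the gradients of the hat functions at the offset `e` and at the origin. -/
noncomputable def stiffnessCoeff (h : ℝ) (d e : ℤ × ℤ) : ℝ :=
  ∫ p : Plane, hatProfile h (p - latticePt h d) *
    inner ℝ (gradient (hatProfile h) (p - latticePt h e)) (gradient (hatProfile h) p)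

lemma int_abs_le_one_of_abs_lt {h : ℝ} (hh : 0 < h) {x : ℝ} {d : ℤ} (h1 : |x| < h)
    (h2 : |x - d * h| < h) : |d| ≤ 1 := by
  have h3 : |(d : ℝ)| * h < 2 * h := by
    calc |(d : ℝ)| * h = |x - (x - d * h)| := by
          rw [sub_sub_cancel, abs_mul, abs_of_pos hh]
      _ ≤ |x| + |x - d * h| := abs_sub _ _
      _ < 2 * h := by linarith
  have h4 : |(d : ℝ)| < 2 := lt_of_mul_lt_mul_right h3 hh.le
  have h5 : |d| < 2 := by exact_mod_cast h4
  omega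

lemma window_of_hatProfile_ne_zero {h : ℝ} (hh : 0 < h) {p : Plane} {d : ℤ × ℤ}
    (h1 : hatProfile h p ≠ 0) (h2 : hatProfile h (p - latticePt h d) ≠ 0) :
    InWindow d := by
  have h3 := abs_lt_of_hatProfile_ne_zero hh h1
  have h4 := abs_lt_of_hatProfile_ne_zero hh h2
  simp only [latticePt, PiLp.sub_apply] at h4
  exact ⟨int_abs_le_one_of_abs_lt hh h3.1 (by simpa using h4.1),
    int_abs_le_one_of_abs_lt hh h3.2 (by simpa using h4.2)⟩

lemma stiffnessCoeff_eq_zero_left {h : ℝ} (hh : 0 < h) {d : ℤ × ℤ} (e : ℤ × ℤ)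
    (hd : ¬ InWindow d) : stiffnessCoeff h d e = 0 := by
  refine integral_eq_zero_of_ae (Filter.Eventually.of_forall fun p => ?_)
  by_contra hne
  simp only [Pi.zero_apply, mul_eq_zero, not_or] at hne
  refine hd (window_of_hatProfile_ne_zero hh (hatProfile_ne_zero_of_gradient ?_) hne.1)
  intro h0
  exact hne.2 (by rw [h0, inner_zero_right])

lemma stiffnessCoeff_eq_zero_right {h : ℝ} (hh : 0 < h) (d : ℤ × ℤ) {e : ℤ × ℤ}
    (he : ¬ InWindow e) : stiffnessCoeff h d e = 0 := by
  refine integral_eq_zero_of_ae (Filter.Eventually.of_forall fun p => ?_)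
  by_contra hne
  simp only [Pi.zero_apply, mul_eq_zero, not_or] at hne
  refine he (window_of_hatProfile_ne_zero hh (hatProfile_ne_zero_of_gradient (p := p) ?_)
    (hatProfile_ne_zero_of_gradient ?_))
  · intro h0
    exact hne.2 (by rw [h0, inner_zero_right])
  · intro h0
    exact hne.2 (by rw [h0, inner_zero_left])

lemma mem_unitSquare_of_hat_ne_zero {N : ℕ} {i : Node N} {p : Plane} (hp : hat N i p ≠ 0) :
    p ∈ unitSquare := by
  have hh := meshWidth_pos N
  rw [hat_eq] at hp
  obtain ⟨h0, h1⟩ := abs_lt_of_hatProfile_ne_zero hh hp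
  have aux : ∀ (x : ℝ) (n : Fin N), |x - ((n : ℝ) + 1) * meshWidth N| < meshWidth N →
      x ∈ Set.Icc (0 : ℝ) 1 := by
    intro x n hx
    have hx := abs_lt.1 hx
    have hn : (n : ℝ) + 1 ≤ N := by exact_mod_cast n.2
    have hN : ((N : ℝ) + 1) * meshWidth N = 1 := by
      unfold meshWidth; field_simp
    have h1 : ((n : ℝ) + 1) * meshWidth N ≤ N * meshWidth N := by gcongr
    have h2 : 0 ≤ (n : ℝ) * meshWidth N := by positivity
    constructor <;> nlinarith
  simp only [latticePt, nodeIdx, PiLp.sub_apply] at h0 h1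
  intro k
  fin_cases k
  · exact aux _ i.1 (by simpa using h0)
  · exact aux _ i.2 (by simpa using h1)

lemma hat_ne_zero_of_gradient {N : ℕ} {i : Node N} {p : Plane} (hp : gradient (hat N i) p ≠ 0) :
    hat N i p ≠ 0 := by
  rw [gradient_hat] at hp
  rw [hat_eq]
  exact hatProfile_ne_zero_of_gradient hp

/-- The domain of integration may be enlarged to the plane, as the gradient of the hat function of
an interior node is supported in the unit square; then the integral is translation invariant. -/
lemma stiffness_eq (N : ℕ) (κ : Node N → ℝ) (i j : Node N) :
    stiffness N κ i j = ∑ k, κ k *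
      stiffnessCoeff (meshWidth N) (nodeIdx k - nodeIdx i) (nodeIdx j - nodeIdx i) := by
  set h := meshWidth N with hdef
  obtain ⟨K, hK⟩ := exists_norm_gradient_le h
  have hK0 : 0 ≤ K := (norm_nonneg _).trans (hK 0)
  have hg : ∀ (i : Node N) p, ‖gradient (hat N i) p‖ ≤ K := fun i p => by
    rw [gradient_hat]; exact hK _
  have hint : ∀ k : Node N, IntegrableOn (fun p => κ k * (hat N k p *
      inner ℝ (gradient (hat N j) p) (gradient (hat N i) p))) unitSquare := by
    intro k
    refine Integrable.const_mul ?_ _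
    refine Measure.integrableOn_of_bounded (M := 1 * (K * K)) volume_unitSquare_lt_top.ne ?_ ?_
    · have hm : Measurable (hat N k) := by
        have : hat N k = fun p => hatProfile h (p - latticePt h (nodeIdx k)) := funext (hat_eq N k)
        rw [this]
        exact ((continuous_hatProfile h).comp (continuous_id.sub continuous_const)).measurable
      exact (hm.mul ((measurable_gradient _).inner (measurable_gradient _))).aestronglyMeasurable
    · refine Filter.Eventually.of_forall fun p => ?_
      rw [norm_mul]
      refine mul_le_mul ?_ ((norm_inner_le_norm _ _).trans
        (mul_le_mul (hg _ _) (hg _ _) (norm_nonneg _) hK0)) (norm_nonneg _) zero_le_one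
      rw [hat_eq, Real.norm_of_nonneg (hatProfile_nonneg _ _)]
      exact hatProfile_le_one _ _
  have hsum : ∀ p, feFun N κ p * inner ℝ (gradient (hat N j) p) (gradient (hat N i) p) =
      ∑ k, κ k * (hat N k p * inner ℝ (gradient (hat N j) p) (gradient (hat N i) p)) := fun p => by
    simp only [feFun, Finset.sum_mul, mul_assoc]
  unfold stiffness
  simp only [hsum]
  rw [integral_finsetSum _ fun k _ => hint k]
  refine Finset.sum_congr rfl fun k _ => ?_
  rw [integral_const_mul, setIntegral_eq_integral_of_forall_compl_eq_zero]
  · congr 1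
    unfold stiffnessCoeff
    refine Eq.trans ?_ (integral_sub_right_eq_self _ (latticePt h (nodeIdx i)))
    refine integral_congr_ae (Filter.Eventually.of_forall fun p => ?_)
    have hshift : ∀ d : ℤ × ℤ, p - latticePt h (nodeIdx i) - latticePt h (d - nodeIdx i) =
        p - latticePt h d := by
      intro d
      have := latticePt_add h (d - nodeIdx i) (nodeIdx i)
      rw [sub_add_cancel] at this
      rw [this]
      abel
    simp only [hshift, gradient_hat, hat_eq, ← hdef]
  · intro p hp
    by_cases h0 : gradient (hat N i) p = 0
    · rw [h0, inner_zero_right, mul_zero]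
    · exact absurd (mem_unitSquare_of_hat_ne_zero (hat_ne_zero_of_gradient h0)) hp

/-! ### The discrete `H¹` norm is dominated by the maximum norm -/

lemma exists_coeffNormH1_le (N : ℕ) : ∃ C : ℝ, 0 ≤ C ∧ ∀ x, coeffNormH1 N x ≤ C * ‖x‖ := by
  obtain ⟨K, hK⟩ := exists_lipschitzWith_hatProfile (meshWidth N)
  set n : ℝ := (Fintype.card (Node N) : ℝ) with hn
  set V : ℝ := volume.real unitSquare with hV
  refine ⟨Real.sqrt ((n ^ 2 + (n * K) ^ 2) * V), Real.sqrt_nonneg _, fun x => ?_⟩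
  have hbound : ∀ (g : Node N → ℝ) (b : ℝ), (∀ i, |g i| ≤ b) →
      |∑ i, x i * g i| ≤ n * b * ‖x‖ := by
    intro g b hg
    calc |∑ i, x i * g i| ≤ ∑ i, |x i * g i| := Finset.abs_sum_le_sum_abs _ _
      _ ≤ ∑ _i : Node N, ‖x‖ * b := by
          refine Finset.sum_le_sum fun i _ => ?_
          rw [abs_mul]
          exact mul_le_mul (norm_le_pi_norm x i) (hg i) (abs_nonneg _) (norm_nonneg _)
      _ = n * b * ‖x‖ := by
          rw [Finset.sum_const, nsmul_eq_mul, Finset.card_univ]; ring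
  have hu : ∀ p, |feFun N x p| ≤ n * ‖x‖ := by
    intro p
    have := hbound (fun i => hat N i p) 1 fun i => by
      rw [hat_eq, abs_of_nonneg (hatProfile_nonneg _ _)]
      exact hatProfile_le_one _ _
    simpa [feFun] using this
  have hgrad : ∀ p, ‖gradient (feFun N x) p‖ ≤ n * K * ‖x‖ := by
    intro p
    rw [gradient, LinearIsometryEquiv.norm_map]
    refine norm_fderiv_le_of_lip' ℝ (by positivity) (Filter.Eventually.of_forall fun q => ?_)
    have := hbound (fun i => hat N i q - hat N i p) (K * ‖q - p‖) fun i => by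
      have h := hK.dist_le_mul (q - latticePt (meshWidth N) (nodeIdx i))
        (p - latticePt (meshWidth N) (nodeIdx i))
      rw [dist_sub_right, dist_eq_norm q p, Real.dist_eq] at h
      rw [hat_eq, hat_eq]
      exact h
    rw [Real.norm_eq_abs]
    calc |feFun N x q - feFun N x p| = |∑ i, x i * (hat N i q - hat N i p)| := by
          simp only [feFun, mul_sub, Finset.sum_sub_distrib]
      _ ≤ n * (K * ‖q - p‖) * ‖x‖ := this
      _ = n * K * ‖x‖ * ‖q - p‖ := by ring
  have h1 : ∫ p in unitSquare, feFun N x p ^ 2 ≤ (n * ‖x‖) ^ 2 * V := by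
    refine (Real.le_norm_self _).trans
      (norm_setIntegral_le_of_norm_le_const volume_unitSquare_lt_top fun p _ => ?_)
    rw [norm_pow, Real.norm_eq_abs]
    gcongr
    exact hu p
  have h2 : ∫ p in unitSquare, ‖gradient (feFun N x) p‖ ^ 2 ≤ (n * K * ‖x‖) ^ 2 * V := by
    refine (Real.le_norm_self _).trans
      (norm_setIntegral_le_of_norm_le_const volume_unitSquare_lt_top fun p _ => ?_)
    rw [norm_pow, norm_norm]
    gcongr
    exact hgrad p
  unfold coeffNormH1 normH1
  have hV0 : 0 ≤ V := measureReal_nonneg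
  rw [Real.sqrt_le_iff]
  refine ⟨by positivity, ?_⟩
  rw [mul_pow, Real.sq_sqrt (by positivity)]
  linarith

/-! ### Nine-point stencils -/

/-- The nine offsets in the window, enumerated row by row. -/
def stencilOffset (s : Fin 9) : ℤ × ℤ :=
  (((s : ℕ) / 3 : ℕ) - 1, ((s : ℕ) % 3 : ℕ) - 1)

lemma inWindow_stencilOffset (s : Fin 9) : InWindow (stencilOffset s) := by
  fin_cases s <;> simp [InWindow, stencilOffset]

lemma stencilOffset_injective : Function.Injective stencilOffset := by
  intro s t h
  simp only [stencilOffset, Prod.mk.injEq] at h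
  ext
  omega

lemma exists_stencilOffset {d : ℤ × ℤ} (hd : InWindow d) : ∃ s, stencilOffset s = d := by
  obtain ⟨d₁, d₂⟩ := d
  obtain ⟨h1, h2⟩ := hd
  simp only [abs_le] at h1 h2
  refine ⟨⟨(3 * (d₁ + 1) + (d₂ + 1)).toNat, by omega⟩, ?_⟩
  simp only [stencilOffset, Prod.mk.injEq]
  omega

/-- Expansion of a function supported in the window along the stencil offsets. -/
lemma sum_stencilOffset (g : ℤ × ℤ → ℝ) (hg : ∀ d, ¬ InWindow d → g d = 0) (d : ℤ × ℤ) :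
    ∑ s, (if d = stencilOffset s then 1 else 0) * g (stencilOffset s) = g d := by
  by_cases hd : InWindow d
  · obtain ⟨s, rfl⟩ := exists_stencilOffset hd
    rw [Finset.sum_eq_single s]
    · simp
    · intro t _ ht
      rw [if_neg fun h => ht (stencilOffset_injective h).symm, zero_mul]
    · simp
  · rw [hg d hd]
    refine Finset.sum_eq_zero fun s _ => ?_
    rw [if_neg fun h => hd (by rw [h]; exact inWindow_stencilOffset s), zero_mul]

/-- The array of the values of `u` at the offset `d`, zero where this leaves the array. -/
def shift {w : ℕ} (d : ℤ × ℤ) (u : Node w → ℝ) : Node w → ℝ := fun p =>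
  ∑ q, (if plainOffset q p = d then 1 else 0) * u q

lemma IsLocal.shift {c w : ℕ} (s : Fin 9) (a : Fin c) :
    IsLocal plainOffset (fun (x : Tensor c w) => shift (stencilOffset s) (x a)) :=
  IsLocal.atom (fun d => if d = stencilOffset s then 1 else 0)
    (fun _ hd => if_neg fun h => hd (by rw [h]; exact inWindow_stencilOffset s)) a

/-- The matrix whose entry in the row `i` at the offset number `s` is `a s i`, and whose entries
at offsets outside the window vanish. -/
def stencilMatrix {w : ℕ} (a : Fin 9 → Node w → ℝ) : Matrix (Node w) (Node w) ℝ := fun i j =>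
  ∑ s, (if plainOffset j i = stencilOffset s then 1 else 0) * a s i

lemma stencilMatrix_mulVec {w : ℕ} (a : Fin 9 → Node w → ℝ) (u : Node w → ℝ) :
    (stencilMatrix a).mulVec u = fun i => ∑ s, a s i * shift (stencilOffset s) u i := by
  funext i
  simp only [Matrix.mulVec, dotProduct, stencilMatrix, shift, Finset.sum_mul, Finset.mul_sum]
  rw [Finset.sum_comm]
  exact Finset.sum_congr rfl fun s _ => Finset.sum_congr rfl fun j _ => by ring

/-! ### Prolongation and the Galerkin product of a stencil -/

/-- The values of a coarse hat function at fine nodes, depending on the offset in fine mesh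
widths. -/
noncomputable def interpTap (d : ℤ × ℤ) : ℝ :=
  max 0 (1 - max (max |(d.1 : ℝ) / 2| |(d.2 : ℝ) / 2|) |(d.1 : ℝ) / 2 - (d.2 : ℝ) / 2|)

lemma interpTap_eq_zero {d : ℤ × ℤ} (hd : ¬ InWindow d) : interpTap d = 0 := by
  have aux : ∀ n : ℤ, ¬ |n| ≤ 1 → 1 ≤ |(n : ℝ) / 2| := by
    intro n hn
    have : (2 : ℤ) ≤ |n| := by omega
    have : (2 : ℝ) ≤ |(n : ℝ)| := by exact_mod_cast this
    rw [abs_div, abs_two]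
    linarith
  refine max_eq_left (sub_nonpos.2 ?_)
  rw [InWindow, not_and_or] at hd
  rcases hd with hd | hd
  · exact (aux _ hd).trans ((le_max_left _ _).trans (le_max_left _ _))
  · exact (aux _ hd).trans ((le_max_right _ _).trans (le_max_left _ _))

lemma prolongation_eq (w : ℕ) (j : Node (2 * w + 1)) (I : Node w) :
    prolongation w j I = interpTap (downOffset j I) := by
  have aux : ∀ a b : ℝ, ((a + 1) * meshWidth (2 * w + 1) - (b + 1) * meshWidth w) / meshWidth w =
      (a - (2 * b + 1)) / 2 := by
    intro a b
    unfold meshWidth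
    push_cast
    field_simp
    ring
  have h0 := aux j.1 I.1
  have h1 := aux j.2 I.2
  simp only [prolongation, hat, nodePos, interpTap, downOffset]
  push_cast
  exact congrArg₂ (fun s t : ℝ => max 0 (1 - max (max |s| |t|) |s - t|)) h0 h1

/-- Summation over the entries of a row at one offset evaluates the coarse hat function at the
shifted node. -/
lemma sum_plainOffset_interpTap {w : ℕ} (q : Node (2 * w + 1)) (J : Node w) (e : ℤ × ℤ) :
    ∑ q', (if plainOffset q' q = e then 1 else 0) * interpTap (downOffset q' J) =
      interpTap (downOffset q J + e) := by
  by_cases hw : InWindow (downOffset q J + e)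
  · -- The support of a coarse hat function contains interior fine nodes only.
    obtain ⟨q', hq'⟩ : ∃ q' : Node (2 * w + 1), plainOffset q' q = e := by
      obtain ⟨h1, h2⟩ := hw
      simp only [downOffset, Prod.fst_add, Prod.snd_add, abs_le] at h1 h2
      have hJ1 := J.1.2
      have hJ2 := J.2.2
      refine ⟨(⟨((q.1 : ℤ) + e.1).toNat, by omega⟩, ⟨((q.2 : ℤ) + e.2).toNat, by omega⟩), ?_⟩
      ext
      · simp only [plainOffset]; omega
      · simp only [plainOffset]; omega
    rw [Finset.sum_eq_single q']
    · rw [if_pos hq', one_mul, ← hq']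
      congr 1
      ext <;> simp [downOffset, plainOffset]
    · intro q'' _ hne
      rw [if_neg, zero_mul]
      intro h
      apply hne
      rw [← hq'] at h
      simp only [plainOffset, Prod.mk.injEq] at h
      ext <;> omega
    · simp
  · rw [interpTap_eq_zero hw]
    refine Finset.sum_eq_zero fun q' _ => ?_
    split_ifs with h
    · rw [one_mul]
      apply interpTap_eq_zero
      convert hw using 2
      rw [← h]
      ext <;> simp [downOffset, plainOffset]
    · rw [zero_mul]

/-- The taps of the strided convolution which maps a stencil to its Galerkin product. -/
noncomputable def galerkinTap (s S : Fin 9) (d : ℤ × ℤ) : ℝ :=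
  interpTap d * interpTap (d + stencilOffset s - (2 : ℤ) • stencilOffset S)

/-- The coarse stencil of the Galerkin product. -/
noncomputable def coarseStencil {w : ℕ} (a : Fin 9 → Node (2 * w + 1) → ℝ) (S : Fin 9) :
    Node w → ℝ := fun p => ∑ s, ∑ q, galerkinTap s S (downOffset q p) * a s q

/-- The Galerkin product of a nine-point stencil is again a nine-point stencil: two coarse nodes
at an offset `D` interact through fine offsets `d` and `d + e - 2 D` in the window, with `e` in
the window, so that `2 |D| ≤ 3`. -/
lemma galerkin_stencilMatrix {w : ℕ} (a : Fin 9 → Node (2 * w + 1) → ℝ) :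
    (prolongation w).transpose * stencilMatrix a * prolongation w =
      stencilMatrix (coarseStencil a) := by
  ext I J
  have hD : ∀ q : Node (2 * w + 1),
      downOffset q J = downOffset q I - (2 : ℤ) • plainOffset J I := by
    intro q
    ext <;> simp [downOffset, plainOffset] <;> ring
  have hexp : ∀ (s : Fin 9) (d : ℤ × ℤ),
      interpTap d * interpTap (d - (2 : ℤ) • plainOffset J I + stencilOffset s) =
      ∑ S, (if plainOffset J I = stencilOffset S then 1 else 0) * galerkinTap s S d := by
    intro s d
    rw [show d - (2 : ℤ) • plainOffset J I + stencilOffset s =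
      d + stencilOffset s - (2 : ℤ) • plainOffset J I by abel]
    refine (sum_stencilOffset
      (fun D => interpTap d * interpTap (d + stencilOffset s - (2 : ℤ) • D)) ?_ _).symm
    intro D hDw
    by_cases hd : InWindow d
    · by_cases hd' : InWindow (d + stencilOffset s - (2 : ℤ) • D)
      · exfalso
        have hs := inWindow_stencilOffset s
        apply hDw
        simp only [InWindow, abs_le, Prod.fst_add, Prod.snd_add, Prod.fst_sub, Prod.snd_sub,
          Prod.smul_fst, Prod.smul_snd, smul_eq_mul] at *
        omega
      · simp only [interpTap_eq_zero hd', mul_zero]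
    · simp only [interpTap_eq_zero hd, zero_mul]
  calc ((prolongation w).transpose * stencilMatrix a * prolongation w) I J
      = ∑ q, ∑ s, a s q * (interpTap (downOffset q I) *
          ∑ q', (if plainOffset q' q = stencilOffset s then 1 else 0) *
            interpTap (downOffset q' J)) := by
        simp only [Matrix.mul_apply, Matrix.transpose_apply, prolongation_eq, stencilMatrix,
          Finset.sum_mul, Finset.mul_sum]
        rw [Finset.sum_comm]
        refine Finset.sum_congr rfl fun q _ => ?_
        rw [Finset.sum_comm]
        exact Finset.sum_congr rfl fun s _ => Finset.sum_congr rfl fun q' _ => by ring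
    _ = ∑ q, ∑ s, a s q * ∑ S, (if plainOffset J I = stencilOffset S then 1 else 0) *
          galerkinTap s S (downOffset q I) := by
        simp only [sum_plainOffset_interpTap]
        simp only [hD, hexp]
    _ = stencilMatrix (coarseStencil a) I J := by
        simp only [stencilMatrix, coarseStencil, Finset.mul_sum]
        rw [Finset.sum_congr rfl fun q _ => Finset.sum_comm, Finset.sum_comm]
        refine Finset.sum_congr rfl fun S _ => ?_
        rw [Finset.sum_comm]
        exact Finset.sum_congr rfl fun s _ => Finset.sum_congr rfl fun q _ => by ring

/-! ### The V-cycle on states -/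

/-- The internal tensors of the networks: the channels `0` to `3` hold the iterate, the residual,
the right-hand side and, on the finest level only, the coefficient of the equation; the last nine
hold the stencil of the operator on the current level. -/
abbrev State (w : ℕ) := Tensor (4 + 9) w

namespace State

variable {w : ℕ}

/-- The operator encoded in a state. -/
def op (x : State w) : Matrix (Node w) (Node w) ℝ := stencilMatrix fun s => x (Fin.natAdd 4 s)

/-- The two states agree up to the iterate and the residual. -/
def SameData (x y : State w) : Prop := ∀ b, b ≠ 0 → b ≠ 1 → x b = y b

lemma SameData.trans {x y z : State w} (h : SameData x y) (h' : SameData y z) : SameData x z :=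
  fun b h0 h1 => (h b h0 h1).trans (h' b h0 h1)

lemma natAdd_ne_zero (s : Fin 9) : (Fin.natAdd 4 s : Fin (4 + 9)) ≠ 0 := by
  intro h
  have := congrArg Fin.val h
  simp at this

lemma natAdd_ne_one (s : Fin 9) : (Fin.natAdd 4 s : Fin (4 + 9)) ≠ 1 := by
  intro h
  have := congrArg Fin.val h
  simp at this
  omega

lemma SameData.op_eq {x y : State w} (h : SameData x y) : x.op = y.op := by
  unfold op
  congr 1
  funext s
  exact h _ (natAdd_ne_zero s) (natAdd_ne_one s)

lemma SameData.rhs_eq {x y : State w} (h : SameData x y) : x 2 = y 2 :=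
  h 2 (by decide) (by decide)

/-- Subtraction of the contribution of one offset from the residual channel. -/
def subtractTerm (s : Fin 9) (x : State w) : State w :=
  Function.update x 1 fun p => x 1 p - x (Fin.natAdd 4 s) p * shift (stencilOffset s) (x 0) p

/-- Storing the residual `f - A u` in its channel. -/
def residual (x : State w) : State w := Function.update x 1 (x 2 - x.op.mulVec (x 0))

/-- One Richardson step. -/
def smooth (ω : ℝ) (x : State w) : State w :=
  Function.update x.residual 0 fun p => x 0 p + ω * x.residual 1 p

lemma foldl_subtractTerm (l : List (Fin 9)) (x : State w) :
    l.foldl (fun y s => subtractTerm s y) x = Function.update x 1 fun p => x 1 p -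
      (l.map fun s => x (Fin.natAdd 4 s) p * shift (stencilOffset s) (x 0) p).sum := by
  induction l generalizing x with
  | nil => simp
  | cons s l ih =>
    rw [List.foldl_cons, ih]
    have h0 : (0 : Fin (4 + 9)) ≠ 1 := by decide
    simp only [subtractTerm, Function.update_self, Function.update_idem,
      Function.update_of_ne (natAdd_ne_one _), Function.update_of_ne h0, List.map_cons,
      List.sum_cons, sub_sub]

lemma residual_eq_foldl (x : State w) : x.residual =
    (List.finRange 9).foldl (fun y s => subtractTerm s y) (Function.update x 1 (x 2)) := by
  have h0 : (0 : Fin (4 + 9)) ≠ 1 := by decide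
  rw [foldl_subtractTerm]
  simp only [residual, op, stencilMatrix_mulVec, Function.update_self, Function.update_idem,
    Function.update_of_ne (natAdd_ne_one _), Function.update_of_ne h0, ← List.sum_ofFn,
    List.ofFn_eq_map]
  rfl

lemma sameData_residual (x : State w) : SameData x.residual x :=
  fun _ _ h1 => Function.update_of_ne h1 _ _

lemma residual_apply_zero (x : State w) : x.residual 0 = x 0 :=
  Function.update_of_ne (by decide) _ _

lemma residual_apply_one (x : State w) : x.residual 1 = x 2 - x.op.mulVec (x 0) :=
  Function.update_self _ _ _

lemma sameData_smooth (ω : ℝ) (x : State w) : SameData (x.smooth ω) x :=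
  fun b h0 h1 => (Function.update_of_ne h0 _ _).trans (sameData_residual x b h0 h1)

lemma smooth_apply_zero (ω : ℝ) (x : State w) :
    x.smooth ω 0 = richardson ω x.op (x 2) (x 0) := by
  unfold smooth
  rw [Function.update_self, residual_apply_one]
  rfl

lemma iterate_smooth (ω : ℝ) (k : ℕ) (x : State w) :
    SameData ((smooth ω)^[k] x) x ∧
      ((smooth ω)^[k] x) 0 = (richardson ω x.op (x 2))^[k] (x 0) := by
  induction k with
  | zero => exact ⟨fun _ _ _ => rfl, rfl⟩
  | succ k ih =>
    rw [Function.iterate_succ_apply', Function.iterate_succ_apply']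
    refine ⟨(sameData_smooth ω _).trans ih.1, ?_⟩
    rw [smooth_apply_zero, ih.1.op_eq, ih.1.rhs_eq, ih.2]

/-- The state of the coarse problem: restricted residual, coarse stencil, initial iterate zero. -/
noncomputable def restrict (x : State (2 * w + 1)) : State w :=
  Fin.append ![0, 0, fun p => ∑ q, interpTap (downOffset q p) * x 1 q, 0]
    (coarseStencil fun s => x (Fin.natAdd 4 s))

lemma restrict_apply_zero (x : State (2 * w + 1)) : x.restrict 0 = 0 := rfl

lemma restrict_apply_two (x : State (2 * w + 1)) :
    x.restrict 2 = (prolongation w).transpose.mulVec (x 1) := by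
  funext p
  simp only [Matrix.mulVec, dotProduct, Matrix.transpose_apply, prolongation_eq]
  rfl

lemma restrict_op (x : State (2 * w + 1)) :
    x.restrict.op = (prolongation w).transpose * x.op * prolongation w := by
  unfold op
  rw [galerkin_stencilMatrix]
  congr 1
  funext s
  exact Fin.append_right _ _ s

/-- The prolongation of the iterate. -/
noncomputable def prolong (x : State w) : Tensor 1 (2 * w + 1) := fun _ p =>
  ∑ q, interpTap (upOffset q p) * x 0 q

lemma prolong_apply (x : State w) (b : Fin 1) : x.prolong b = (prolongation w).mulVec (x 0) := by
  funext p
  simp only [Matrix.mulVec, dotProduct, prolongation_eq]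
  rfl

/-- Addition of the correction in the last channel to the iterate. -/
def correct (y : Tensor (4 + 9 + 1) w) : State w :=
  Function.update (fun b => y (Fin.castAdd 1 b)) 0 fun p => y 0 p + y (Fin.last _) p

/-- The V-cycle as a map of states. -/
noncomputable def vCycleMap (n₀ : ℕ) (ω : ℝ) (k₀ k : ℕ) :
    (ℓ : ℕ) → State (levelNodes n₀ ℓ) → State (levelNodes n₀ ℓ)
  | 0 => (smooth ω)^[k₀]
  | ℓ + 1 => fun x =>
    let y : State (2 * levelNodes n₀ ℓ + 1) := residual ((smooth ω)^[k] x)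
    (smooth ω)^[k] (correct (Fin.append y (prolong (vCycleMap n₀ ω k₀ k ℓ (restrict y)))))

lemma vCycleMap_spec (n₀ : ℕ) (ω : ℝ) (k₀ k ℓ : ℕ) (x : State (levelNodes n₀ ℓ)) :
    SameData (vCycleMap n₀ ω k₀ k ℓ x) x ∧
      vCycleMap n₀ ω k₀ k ℓ x 0 = vCycle n₀ ω k₀ k ℓ x.op (x 2) (x 0) := by
  induction ℓ with
  | zero => exact iterate_smooth ω k₀ x
  | succ ℓ ih =>
    obtain ⟨hs, hv⟩ := iterate_smooth ω k x
    set v := (smooth ω)^[k] x with hvdef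
    set y : State (2 * levelNodes n₀ ℓ + 1) := residual v with hy
    have hyx : SameData y x := (sameData_residual v).trans hs
    set e := vCycleMap n₀ ω k₀ k ℓ (restrict y) with he
    set z : State (2 * levelNodes n₀ ℓ + 1) := correct (Fin.append y e.prolong) with hz
    have hzy : SameData z y := fun b h0 _ =>
      (Function.update_of_ne h0 _ _).trans (Fin.append_left _ _ b)
    have hzx := hzy.trans hyx
    have hz0 : z 0 = y 0 + e.prolong 0 := by
      rw [hz, correct, Function.update_self]
      funext p
      exact congrArg₂ (· + ·) (congrFun (Fin.append_left y e.prolong 0) p)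
        (congrFun (Fin.append_right y e.prolong 0) p)
    obtain ⟨hs', hv'⟩ := iterate_smooth ω k z
    have hy0 : y 0 = v 0 := residual_apply_zero v
    have hy1 : y 1 = v 2 - v.op.mulVec (v 0) := residual_apply_one v
    refine ⟨hs'.trans hzx, hv'.trans ?_⟩
    rw [hzx.op_eq, hzx.rhs_eq, hz0, prolong_apply, he, (ih _).2, restrict_op, restrict_apply_zero,
      restrict_apply_two, hyx.op_eq, hy0, hy1, hs.op_eq,
      hs.rhs_eq, hv]
    rfl

end State

/-! ### Networks for the V-cycle -/

namespace CNN.IsUNet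

lemma precomp {d c w c' w' c₀ : ℕ} {f : CNN c w c' w'} (hf : IsUNet d f) {g : CNN c₀ w c w}
    (hg : IsSingleScale g) : ∃ f' : CNN c₀ w c' w', IsUNet d f' ∧
      f'.numWeights = g.numWeights + f.numWeights ∧
      ∀ ϱ x, f'.realize ϱ x = f.realize ϱ (g.realize ϱ x) := by
  cases hf with
  | coarsest h => exact ⟨_, .coarsest (.comp hg h), rfl, fun _ _ => rfl⟩
  | stage Kd Ku h1 h2 h3 =>
    exact ⟨_, .stage Kd Ku (.comp hg h1) h2 h3, by simp only [numWeights]; ring, fun _ _ => rfl⟩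

lemma postcomp {d c w c' w' c₀ : ℕ} {f : CNN c w c' w'} (hf : IsUNet d f) {g : CNN c' w' c₀ w'}
    (hg : IsSingleScale g) : ∃ f' : CNN c w c₀ w', IsUNet d f' ∧
      f'.numWeights = f.numWeights + g.numWeights ∧
      ∀ ϱ x, f'.realize ϱ x = g.realize ϱ (f.realize ϱ x) := by
  cases hf with
  | coarsest h => exact ⟨_, .coarsest (.comp h hg), rfl, fun _ _ => rfl⟩
  | stage Kd Ku h1 h2 h3 =>
    exact ⟨_, .stage Kd Ku h1 h2 (.comp h3 hg), by simp only [numWeights]; ring, fun _ _ => rfl⟩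

end CNN.IsUNet

namespace Approximable

variable {ϱ : ℝ → ℝ}

/-- Single-scale networks before and after a UNet-like network are absorbed into its single-scale
parts. -/
lemma conj_unet {d c₀ c c' c₁ w W₀ W W₁ : ℕ} {E : Tensor c₀ w → Tensor c w}
    {F : Tensor c w → Tensor c' w} {G : Tensor c' w → Tensor c₁ w}
    (hE : Approximable ϱ CNN.IsSingleScale W₀ E) (hF : Approximable ϱ (CNN.IsUNet d) W F)
    (hG : Approximable ϱ CNN.IsSingleScale W₁ G) :
    Approximable ϱ (CNN.IsUNet d) (W₀ + W + W₁) (fun x => G (F (E x))) := by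
  have h₁ := hF.comp hE (T := fun Φ => ∃ (a : CNN c₀ w c w) (b : CNN c w c' w),
    a.IsSingleScale ∧ b.IsUNet d ∧ Φ = a.comp b) fun _ _ ha hb => ⟨_, _, ha, hb, rfl⟩
  have h := hG.comp h₁ (T := fun Φ => ∃ (a : CNN c₀ w c w) (b : CNN c w c' w) (e : CNN c' w c₁ w),
    a.IsSingleScale ∧ b.IsUNet d ∧ e.IsSingleScale ∧ Φ = (a.comp b).comp e) (by
      rintro _ e ⟨a, b, ha, hb, rfl⟩ he
      exact ⟨a, b, e, ha, hb, he, rfl⟩)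
  refine ⟨h.1, fun R ε hε => ?_⟩
  obtain ⟨_, ⟨a, b, e, ha, hb, he, rfl⟩, hW, hΦ⟩ := h.2 R ε hε
  obtain ⟨b', hb', hWb', hrb'⟩ := hb.precomp ha
  obtain ⟨b'', hb'', hWb'', hrb''⟩ := hb'.postcomp he
  refine ⟨b'', hb'', ?_, fun x hx => ?_⟩
  · rw [hWb'', hWb']
    exact hW
  · rw [hrb'', hrb']
    exact hΦ x hx

/-- One down- and upsampling stage. -/
lemma stage {d c c₁ c₂ c₃ c₄ c' w W₁ W₂ W₃ : ℕ}
    {pre : Tensor c (2 * w + 1) → Tensor c₁ (2 * w + 1)}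
    {down : Tensor c₁ (2 * w + 1) → Tensor c₂ w} {F : Tensor c₂ w → Tensor c₃ w}
    {up : Tensor c₃ w → Tensor c₄ (2 * w + 1)}
    {post : Tensor (c₁ + c₄) (2 * w + 1) → Tensor c' (2 * w + 1)}
    (hpre : Approximable ϱ CNN.IsSingleScale W₁ pre)
    (hdown : ∀ b, IsLocal downOffset (fun x => down x b))
    (hF : Approximable ϱ (CNN.IsUNet d) W₂ F)
    (hup : ∀ b, IsLocal upOffset (fun x => up x b))
    (hpost : Approximable ϱ CNN.IsSingleScale W₃ post) :
    Approximable ϱ (CNN.IsUNet (d + 1))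
      (W₁ + (c₁ * c₂ * 9 + c₂ + (W₂ + (c₃ * c₄ * 9 + c₄)) + W₃))
      (fun x => post (Fin.append (pre x) (up (F (down (pre x)))))) := by
  have h1 := (of_up (ϱ := ϱ) hup).comp hF
    (T := fun Φ => ∃ (b : CNN c₂ w c₃ w) (K : Kernel c₃ c₄ 1), b.IsUNet d ∧ Φ = b.comp (.up K)) (by
      rintro b _ hb ⟨K, rfl⟩
      exact ⟨b, K, hb, rfl⟩)
  have h2 := h1.comp (of_down (ϱ := ϱ) hdown)
    (T := fun Φ => ∃ (K : Kernel c₁ c₂ 1) (b : CNN c₂ w c₃ w) (K' : Kernel c₃ c₄ 1),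
      b.IsUNet d ∧ Φ = .comp (.down K) (b.comp (.up K'))) (by
      rintro _ _ ⟨K, rfl⟩ ⟨b, K', hb, rfl⟩
      exact ⟨K, b, K', hb, rfl⟩)
  have h3 := h2.skip (T := fun Φ => ∃ (K : Kernel c₁ c₂ 1) (b : CNN c₂ w c₃ w)
      (K' : Kernel c₃ c₄ 1), b.IsUNet d ∧ Φ = .skip (.comp (.down K) (b.comp (.up K')))) (by
      rintro _ ⟨K, b, K', hb, rfl⟩
      exact ⟨K, b, K', hb, rfl⟩)
  have h4 := hpost.comp h3 (T := fun Φ => ∃ (K : Kernel c₁ c₂ 1) (b : CNN c₂ w c₃ w)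
      (K' : Kernel c₃ c₄ 1) (e : CNN (c₁ + c₄) (2 * w + 1) c' (2 * w + 1)), b.IsUNet d ∧
      e.IsSingleScale ∧ Φ = .comp (.skip (.comp (.down K) (b.comp (.up K')))) e) (by
      rintro _ e ⟨K, b, K', hb, rfl⟩ he
      exact ⟨K, b, K', e, hb, he, rfl⟩)
  exact h4.comp hpre (by
    rintro a _ ha ⟨K, b, K', e, hb, he, rfl⟩
    exact .stage K K' ha hb he)

end Approximable

lemma IsLocal.interp_down {c w : ℕ} (a : Fin c) : IsLocal downOffset
    (fun (x : Tensor c (2 * w + 1)) (p : Node w) => ∑ q, interpTap (downOffset q p) * x a q) :=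
  IsLocal.atom interpTap (fun _ => interpTap_eq_zero) a

namespace State

variable {w : ℕ} {ϱ : ℝ → ℝ} {x₀ : ℝ}

lemma isLocal_update {c c' : ℕ} {F : Tensor c w → Tensor c' w} {g : Tensor c w → Node w → ℝ}
    (hF : ∀ b, IsLocal plainOffset (fun x => F x b)) (hg : IsLocal plainOffset g) (a b : Fin c') :
    IsLocal plainOffset (fun x => Function.update (F x) a (g x) b) := by
  by_cases h : b = a
  · subst h
    simpa using hg
  · simpa [Function.update_of_ne h] using hF b

/-- The two factors are extracted by a convolution, multiplied, and their product is subtracted by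
a second convolution; `1972` is the sum of `236`, `85` and `1651` weights. -/
lemma approximable_subtractTerm (h : ContDiffAt ℝ 3 ϱ x₀) (h2 : iteratedDeriv 2 ϱ x₀ ≠ 0)
    (s : Fin 9) : Approximable ϱ CNN.IsSingleScale 1972 (subtractTerm (w := w) s) := by
  have hfac : Approximable ϱ CNN.IsSingleScale _ (fun x : State w =>
      (![x (Fin.natAdd 4 s), shift (stencilOffset s) (x 0)] : Tensor 2 w)) :=
    Approximable.of_conv fun b => by
      fin_cases b
      · exact IsLocal.proj _
      · exact IsLocal.shift s 0
  have hmul := ((approximable_mulChannels h h2 w).comp_single hfac).skip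
    (T := CNN.IsSingleScale) fun _ => .skip
  have hsub : Approximable ϱ CNN.IsSingleScale _ (fun y : Tensor (4 + 9 + 1) w =>
      (Function.update (fun b => y (Fin.castAdd 1 b)) 1 fun p => y 1 p - y (Fin.last _) p :
        State w)) :=
    Approximable.of_conv fun b =>
      isLocal_update (fun _ => IsLocal.proj _) ((IsLocal.proj _).sub (IsLocal.proj _)) _ _
  have hall := hsub.comp_single hmul
  convert hall.mono (fun _ => id) (W' := 1972) (by norm_num) using 1
  funext x
  unfold subtractTerm
  congr 1
  funext b
  exact (Fin.append_left _ _ b).symm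

/-- One convolution copies the right-hand side, another one stands for the empty sum, and nine
subtractions follow. -/
lemma approximable_residual (h : ContDiffAt ℝ 3 ϱ x₀) (h2 : iteratedDeriv 2 ϱ x₀ ≠ 0) :
    Approximable ϱ CNN.IsSingleScale 20816 (residual (w := w)) := by
  have hfold : ∀ l : List (Fin 9), Approximable ϱ CNN.IsSingleScale (1534 + l.length * 1972)
      (fun x : State w => l.foldl (fun y s => subtractTerm s y) x) := by
    intro l
    induction l with
    | nil => exact Approximable.of_conv fun b => IsLocal.proj b
    | cons s l ih =>
      exact (ih.comp_single (approximable_subtractTerm h h2 s)).mono (fun _ => id)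
        (by rw [List.length_cons]; omega)
  have hinit : Approximable ϱ CNN.IsSingleScale _ (fun x : State w =>
      (Function.update x 1 (x 2) : State w)) :=
    Approximable.of_conv fun b => isLocal_update IsLocal.proj (IsLocal.proj 2) 1 b
  rw [show residual (w := w) = _ from funext residual_eq_foldl]
  exact ((hfold (List.finRange 9)).comp_single hinit).mono (fun _ => id) (by simp)

lemma approximable_smooth (h : ContDiffAt ℝ 3 ϱ x₀) (h2 : iteratedDeriv 2 ϱ x₀ ≠ 0) (ω : ℝ) :
    Approximable ϱ CNN.IsSingleScale 22350 (smooth (w := w) ω) := by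
  have hup : Approximable ϱ CNN.IsSingleScale _ (fun x : State w =>
      (Function.update x 0 fun p => x 0 p + ω * x 1 p : State w)) :=
    Approximable.of_conv fun b =>
      isLocal_update IsLocal.proj ((IsLocal.proj 0).add ((IsLocal.proj 1).const_mul ω)) 0 b
  convert (hup.comp_single (approximable_residual h h2)).mono (fun _ => id) (W' := 22350)
    (by norm_num) using 1
  funext x
  rw [residual_apply_zero]
  rfl

lemma approximable_iterate_smooth (h : ContDiffAt ℝ 3 ϱ x₀) (h2 : iteratedDeriv 2 ϱ x₀ ≠ 0)
    (ω : ℝ) (k : ℕ) :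
    Approximable ϱ CNN.IsSingleScale (1534 + k * 22350) ((smooth (w := w) ω)^[k]) :=
  (approximable_smooth h h2 ω).iterate k

lemma isLocal_restrict (b : Fin (4 + 9)) :
    IsLocal downOffset (fun x : State (2 * w + 1) => x.restrict b) := by
  have hzero : IsLocal downOffset (fun (_ : State (2 * w + 1)) (_ : Node w) => (0 : ℝ)) :=
    IsLocal.const 0
  induction b using Fin.addCases with
  | left b =>
    simp only [restrict, Fin.append_left]
    fin_cases b
    · exact hzero
    · exact hzero
    · exact IsLocal.interp_down 1
    · exact hzero
  | right S =>
    simp only [restrict, Fin.append_right]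
    refine IsLocal.sum fun s => IsLocal.atom (galerkinTap s S) (fun d hd => ?_) _
    rw [galerkinTap, interpTap_eq_zero hd, zero_mul]

/-- The V-cycle is a UNet-like map: pre-smoothing and residual form the first single-scale part,
correction and post-smoothing the last one, and the coarse-grid correction is the branch. -/
lemma approximable_vCycleMap (h : ContDiffAt ℝ 3 ϱ x₀) (h2 : iteratedDeriv 2 ϱ x₀ ≠ 0)
    (n₀ : ℕ) (ω : ℝ) (k₀ k ℓ : ℕ) :
    Approximable ϱ (CNN.IsUNet ℓ) (1534 + k₀ * 22350 + ℓ * (27187 + k * 44700))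
      (vCycleMap n₀ ω k₀ k ℓ) := by
  induction ℓ with
  | zero =>
    exact (approximable_iterate_smooth h h2 ω k₀).mono (fun _ => .coarsest) (by omega)
  | succ ℓ ih =>
    have hcorr : Approximable ϱ CNN.IsSingleScale _
        (correct (w := 2 * levelNodes n₀ ℓ + 1)) :=
      Approximable.of_conv fun b =>
        isLocal_update (fun _ => IsLocal.proj _) ((IsLocal.proj _).add (IsLocal.proj _)) _ _
    have hpre := (approximable_residual h h2).comp_single
      (approximable_iterate_smooth (w := 2 * levelNodes n₀ ℓ + 1) h h2 ω k)
    have hpost := (approximable_iterate_smooth h h2 ω k).comp_single hcorr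
    have hall := Approximable.stage hpre isLocal_restrict ih (up := prolong)
      (fun b => IsLocal.atom interpTap (fun _ => interpTap_eq_zero) 0) hpost
    exact hall.mono (fun _ => id) (by ring_nf; omega)

/-! ### Encoding of the finite element problem -/

/-- The state which encodes the iterate `x 0`, the coefficient `x 1` and the right-hand
side `x 2`. -/
noncomputable def encode (x : Tensor 3 w) : State w :=
  Fin.append ![x 0, 0, x 2, x 1] fun S p =>
    ∑ q, stiffnessCoeff (meshWidth w) (plainOffset q p) (stencilOffset S) * x 1 q

lemma encode_op (x : Tensor 3 w) : (encode x).op = stiffness w (x 1) := by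
  have hidx : ∀ i j : Node w, nodeIdx j - nodeIdx i = plainOffset j i := by
    intro i j
    ext <;> simp [nodeIdx, plainOffset]
  ext i j
  simp only [op, encode, Fin.append_right, stencilMatrix, stiffness_eq, hidx, Finset.mul_sum]
  rw [Finset.sum_comm]
  refine Finset.sum_congr rfl fun q _ => ?_
  rw [← sum_stencilOffset (stiffnessCoeff (meshWidth w) (plainOffset q i))
    (fun e he => stiffnessCoeff_eq_zero_right (meshWidth_pos w) _ he), Finset.mul_sum]
  exact Finset.sum_congr rfl fun s _ => by ring

lemma approximable_encode : Approximable ϱ CNN.IsSingleScale 364 (encode (w := w)) := by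
  refine Approximable.of_conv fun b => ?_
  induction b using Fin.addCases with
  | left b =>
    simp only [encode, Fin.append_left]
    fin_cases b
    · exact IsLocal.proj 0
    · exact IsLocal.const 0
    · exact IsLocal.proj 2
    · exact IsLocal.proj 1
  | right S =>
    simp only [encode, Fin.append_right]
    exact IsLocal.atom (fun d => stiffnessCoeff (meshWidth w) d (stencilOffset S))
      (fun d hd => stiffnessCoeff_eq_zero_left (meshWidth_pos w) _ hd) 1

end State

/-! ### Composition of V-cycles -/

/-- One V-cycle, keeping coefficient and right-hand side for the next one. -/
lemma approximable_vCycle_step {ϱ : ℝ → ℝ} {x₀ : ℝ} (h : ContDiffAt ℝ 3 ϱ x₀)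
    (h2 : iteratedDeriv 2 ϱ x₀ ≠ 0) (n₀ : ℕ) (ω : ℝ) (k₀ k ℓ : ℕ) :
    Approximable ϱ (CNN.IsUNet ℓ) (2252 + k₀ * 22350 + ℓ * (27187 + k * 44700))
      (fun x : Tensor 3 (levelNodes n₀ ℓ) =>
        (![vCycle n₀ ω k₀ k ℓ (stiffness _ (x 1)) (x 2) (x 0), x 1, x 2] :
          Tensor 3 (levelNodes n₀ ℓ))) := by
  have hdec : Approximable ϱ CNN.IsSingleScale _ (fun y : State (levelNodes n₀ ℓ) =>
      (![y 0, y 3, y 2] : Tensor 3 (levelNodes n₀ ℓ))) :=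
    Approximable.of_conv fun b => by
      fin_cases b
      · exact IsLocal.proj 0
      · exact IsLocal.proj 3
      · exact IsLocal.proj 2
  have := (State.approximable_encode (ϱ := ϱ)).conj_unet
    (State.approximable_vCycleMap h h2 n₀ ω k₀ k ℓ) hdec
  convert this.mono (fun _ => id) (W' := 2252 + k₀ * 22350 + ℓ * (27187 + k * 44700)) (by omega)
    using 1
  funext x
  obtain ⟨hs, hv⟩ := State.vCycleMap_spec n₀ ω k₀ k ℓ (State.encode x)
  rw [hv, State.encode_op, hs 3 (by decide) (by decide), hs 2 (by decide) (by decide)]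
  rfl

lemma approximable_multigrid {ϱ : ℝ → ℝ} {x₀ : ℝ} (h : ContDiffAt ℝ 3 ϱ x₀)
    (h2 : iteratedDeriv 2 ϱ x₀ ≠ 0) (n₀ : ℕ) (ω : ℝ) (k₀ k ℓ m : ℕ) (hm : 1 ≤ m) :
    Approximable ϱ (CNN.IsUNetSequence ℓ m)
      (m * (2364 + k₀ * 22350 + ℓ * (27187 + k * 44700)))
      (fun x : Tensor 3 (levelNodes n₀ ℓ) =>
        ((fun _ => multigrid n₀ ω k₀ k m ℓ (x 0) (x 1) (x 2)) : Tensor 1 (levelNodes n₀ ℓ))) := by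
  have hstep := approximable_vCycle_step h h2 n₀ ω k₀ k ℓ
  induction m, hm using Nat.le_induction with
  | base =>
    have hid : Approximable ϱ CNN.IsSingleScale _ (fun x : Tensor 3 (levelNodes n₀ ℓ) => x) :=
      Approximable.of_conv fun b => IsLocal.proj b
    have hfst : Approximable ϱ CNN.IsSingleScale _ (fun x : Tensor 3 (levelNodes n₀ ℓ) =>
        ((fun _ => x 0) : Tensor 1 (levelNodes n₀ ℓ))) :=
      Approximable.of_conv fun b => IsLocal.proj 0
    exact (hid.conj_unet hstep hfst).mono (fun _ => .single) (by omega)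
  | succ m hm ih =>
    have := ih.comp hstep (T := CNN.IsUNetSequence ℓ (m + 1)) fun _ _ => .cons
    exact this.mono (fun _ => id) (by rw [Nat.succ_mul]; omega)

lemma le_two_mul_log_meshWidth (n₀ ℓ : ℕ) :
    (ℓ : ℝ) ≤ 2 * Real.log (1 / meshWidth (levelNodes n₀ ℓ)) := by
  have hpow : (2 : ℝ) ^ ℓ ≤ (levelNodes n₀ ℓ : ℝ) + 1 := by
    induction ℓ with
    | zero => simp [levelNodes]
    | succ ℓ ih =>
      rw [levelNodes, pow_succ]
      push_cast
      linarith
  have hlog := Real.log_le_log (by positivity) hpow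
  rw [Real.log_pow] at hlog
  rw [meshWidth, one_div_one_div]
  have h2 := Real.log_two_gt_d9
  have : (ℓ : ℝ) * (1 / 2) ≤ ℓ * Real.log 2 := by gcongr; linarith
  linarith

end MultigridCNN

theorem theorem4p1 :
    ∃ C : ℝ, 0 < C ∧
      ∀ (ϱ : ℝ → ℝ) (x₀ : ℝ), ContDiffAt ℝ 3 ϱ x₀ → iteratedDeriv 2 ϱ x₀ ≠ 0 →
      -- coarsest mesh with `n₀` interior nodes per direction, `ℓ` refinements up to the mesh of `V_h`
      ∀ (n₀ ℓ : ℕ) (ω : ℝ), 0 < ω →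
      ∀ (M ε : ℝ), 0 < M → 0 < ε →
      ∀ (m k k₀ : ℕ), 1 ≤ m → 1 ≤ k → 1 ≤ k₀ →
      ∃ Ψ : MultigridCNN.CNN 3 (MultigridCNN.levelNodes n₀ ℓ) 1 (MultigridCNN.levelNodes n₀ ℓ),
        Ψ.IsUNetSequence ℓ m ∧
        (∀ u₀ κ f : MultigridCNN.Node (MultigridCNN.levelNodes n₀ ℓ) → ℝ,
          (∀ i, u₀ i ∈ Set.Icc (-M) M) → (∀ i, κ i ∈ Set.Icc (-M) M) →
          (∀ i, f i ∈ Set.Icc (-M) M) →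
          MultigridCNN.coeffNormH1 (MultigridCNN.levelNodes n₀ ℓ)
            (Ψ.realize ϱ ![u₀, κ, f] 0 - MultigridCNN.multigrid n₀ ω k₀ k m ℓ u₀ κ f) ≤ ε) ∧
        (Ψ.numWeights : ℝ) ≤
          C * (k₀ + k * Real.log (1 / MultigridCNN.meshWidth (MultigridCNN.levelNodes n₀ ℓ))) * m := by
  refine ⟨150000, by norm_num, fun ϱ x₀ h h2 n₀ ℓ ω _ M ε hM hε m k k₀ hm hk hk₀ => ?_⟩
  obtain ⟨B, hB0, hB⟩ := MultigridCNN.exists_coeffNormH1_le (MultigridCNN.levelNodes n₀ ℓ)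
  obtain ⟨Ψ, hΨ, hW, happ⟩ := (MultigridCNN.approximable_multigrid h h2 n₀ ω k₀ k ℓ m hm).2
    M (ε / (B + 1)) (by positivity)
  refine ⟨Ψ, hΨ, fun u₀ κ f hu hκ hf => ?_, ?_⟩
  · have hx : ‖(![u₀, κ, f] : MultigridCNN.Tensor 3 (MultigridCNN.levelNodes n₀ ℓ))‖ ≤ M := by
      have hb : ∀ v : MultigridCNN.Node (MultigridCNN.levelNodes n₀ ℓ) → ℝ,
          (∀ i, v i ∈ Set.Icc (-M) M) → ‖v‖ ≤ M := fun v hv =>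
        (pi_norm_le_iff_of_nonneg hM.le).2 fun i => abs_le.2 (hv i)
      refine (pi_norm_le_iff_of_nonneg hM.le).2 fun a => ?_
      fin_cases a
      · exact hb _ hu
      · exact hb _ hκ
      · exact hb _ hf
    have h0 := (norm_le_pi_norm _ 0).trans (happ _ hx)
    calc _ ≤ B * (ε / (B + 1)) := (hB _).trans (mul_le_mul_of_nonneg_left h0 hB0)
      _ ≤ (B + 1) * (ε / (B + 1)) := by gcongr; linarith
      _ = ε := by field_simp
  · set lg := Real.log (1 / MultigridCNN.meshWidth (MultigridCNN.levelNodes n₀ ℓ))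
    have hlog : (ℓ : ℝ) ≤ 2 * lg := MultigridCNN.le_two_mul_log_meshWidth n₀ ℓ
    have hW' : (Ψ.numWeights : ℝ) ≤
        m * (2364 + k₀ * 22350 + ℓ * (27187 + k * 44700)) := by exact_mod_cast hW
    have hk' : (1 : ℝ) ≤ k := by exact_mod_cast hk
    have hk₀' : (1 : ℝ) ≤ k₀ := by exact_mod_cast hk₀
    have hℓ : (0 : ℝ) ≤ ℓ := ℓ.cast_nonneg
    have h1 : (ℓ : ℝ) * (27187 + k * 44700) ≤ 150000 * (k * lg) := by
      calc (ℓ : ℝ) * (27187 + k * 44700) ≤ ℓ * (k * 75000) := by gcongr; linarith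
        _ ≤ (2 * lg) * (k * 75000) := by gcongr
        _ = 150000 * (k * lg) := by ring
    calc (Ψ.numWeights : ℝ) ≤ m * (2364 + k₀ * 22350 + ℓ * (27187 + k * 44700)) := hW'
      _ ≤ m * (150000 * (k₀ + k * lg)) := by gcongr; linarith
      _ = 150000 * (k₀ + k * lg) * m := by ring
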